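/- **Setting.** Let $f:\mathbb R^n\to\mathbb R$ be convex and $L$-smooth ($L>0$: $f$ is differentiable and $\nabla f$ is $L$-Lipschitz in the Euclidean norm), let $x^*$ be a minimizer of $f$, $x^0\in\mathbb R^n$, and $R_0=\|x^0-x^*\|_2>0$. Let $\xi$ be a random variable and $\nabla f(x,\xi)$ a stochastic gradient (jointly measurable in $(x,\xi)$) with $\mathbb E_\xi[\nabla f(x,\xi)]=\nabla f(x)$ and $\mathbb E_\xi\|\nabla f(x,\xi)-\nabla f(x)\|_2^2\le\sigma^2$ for all $x$, where $\sigma\ge 0$. Let $\beta\in(0,1)$ and $C=\sqrt5$. **Method (clipped-SSTM).** Given $N$, $a$, $B$ and batchsizes $m_k$, put $A_0=\alpha_0=0$, $y^0=z^0=x^0$ and, for $k=0,\dots,N-1$, $\alpha_{k+1}=\frac{k+2}{2aL}$, $A_{k+1}=A_k+\alpha_{k+1}$, $x^{k+1}=\frac{A_ky^k+\alpha_{k+1}z^k}{A_{k+1}}$, $g^{k+1}=\frac1{m_k}\sum_{i=1}^{m_k}\nabla f(x^{k+1},\xi_i^k)$ with fresh i.i.d. samples $\xi_i^k$ distributed as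 $\xi$, $\tilde g^{k+1}=\min\{1,\frac{B}{\alpha_{k+1}\|g^{k+1}\|_2}\}\,g^{k+1}$ (equal to $0$ if $g^{k+1}=0$), $z^{k+1}=z^k-\alpha_{k+1}\tilde g^{k+1}$, $y^{k+1}=\frac{A_ky^k+\alpha_{k+1}z^{k+1}}{A_{k+1}}$. The output is $y^N$ and the number of oracle calls is $\sum_{k=0}^{N-1}m_k$. The clipping parameter is $B=\frac{CR_0}{8\ln(4N/\beta)}$, and the batchsize is (rounded up to an integer) $$m_k=\max\Big\{1,\tfrac{6000\sigma^2\alpha_{k+1}^2N\ln\frac{4N}\beta}{C^2R_0^2},\tfrac{10368\sigma^2\alpha_{k+1}^2N}{C^2R_0^2}\Big\}.$$ Call $(N,a)$ *admissible* if $N\ge1$, $\ln\frac{4N}\beta\ge2$ and $$a\ge\max\Big\{1,\tfrac{16\ln\frac{4N}\beta}{C},36\Big(2\ln\tfrac{4N}\beta+\sqrt{4\ln^2\tfrac{4N}\beta+2\ln\tfrac{4N}\beta}\Big)^2\Big\}.$$ **Claim.** There are numerical constants $K,K'>0$, independent of all the data ($n,f,x^0,x^*,L,\sigma,\beta$, the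 stochastic gradient and the distribution of $\xi$, and $N,\varepsilon,a_0$ below), such that the following holds. 1. *(Medium batchsize.)* Put $a=N\ln\frac{4N}\beta$ and, for $\varepsilon>0$, $T=\frac{LR_0^2}\varepsilon\ln\frac{LR_0^2}{\varepsilon\beta}$. If $(N,a)$ is admissible, then before rounding $$m_k=\max\Big\{1,\tfrac{6000\sigma^2(k+2)^2}{4L^2NC^2R_0^2\ln\frac{4N}\beta},\tfrac{10368\sigma^2(k+2)^2}{4L^2C^2R_0^2N\ln^2\frac{4N}\beta}\Big\};$$ for every $\varepsilon>0$ with $N\ge KT$ one has $f(y^N)-f(x^*)\le\varepsilon$ with probability at least $1-\beta$; and for every $\varepsilon>0$ with $N\le2KT$ the number of oracle calls is at most $$K'\max\Big\{\tfrac{LR_0^2}\varepsilon,\tfrac{\sigma^2R_0^2}{\varepsilon^2}\Big\}\ln\tfrac{LR_0^2}{\varepsilon\beta}.$$ If $0<\varepsilon\le\frac12LR_0^2$, there is $N$ with $KT\le N\le2KT$ for which $(N,a)$ is admissible. 2. *(Constant batchsize.)* Let $a_0>0$, put $a=a_0N^{3/2}\sqrt{\ln\frac{4N}\beta}$ and,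 for $\varepsilon>0$, $T=\frac{a_0^2L^2R_0^4}{\varepsilon^2}\ln\frac{a_0LR_0^2}{\varepsilon\beta}$. If $(N,a)$ is admissible, then before rounding $$m_k=\max\Big\{1,\tfrac{6000\sigma^2(k+2)^2}{4a_0^2L^2N^2C^2R_0^2},\tfrac{10368\sigma^2(k+2)^2}{4a_0^2L^2C^2R_0^2N^2\ln\frac{4N}\beta}\Big\};$$ for every $0<\varepsilon\le\frac12a_0LR_0^2$ with $N\ge KT$ one has $f(y^N)-f(x^*)\le\varepsilon$ with probability at least $1-\beta$; and for every $\varepsilon>0$ with $N\le2KT$ the number of oracle calls is at most $$K'\max\Big\{\tfrac{a_0^2L^2R_0^4}{\varepsilon^2},\tfrac{\sigma^2R_0^2}{\varepsilon^2}\Big\}\ln\tfrac{a_0LR_0^2}{\varepsilon\beta}.$$ If $0<\varepsilon\le\frac12a_0LR_0^2$ and $\varepsilon^3\le a_0^4(LR_0^2)^3$, there is $N$ with $KT\le N\le2KT$ for which $(N,a)$ is admissible. Finally, let $\sigma>0$ and $a_0=\frac\sigma{LR_0}$, so that $T=\frac{\sigma^2R_0^2}{\varepsilon^2}\ln\frac{\sigma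 R_0}{\varepsilon\beta}$. If $(N,a)$ is admissible, then $m_k\le K'$ for $k=0,\dots,N$ (so each iteration needs at most $K'$ oracle calls), and for every $0<\varepsilon\le\frac12\sigma R_0$ with $N\ge KT$ one has $f(y^N)-f(x^*)\le\varepsilon$ with probability at least $1-\beta$. If $0<\varepsilon\le\frac12\sigma R_0$ and $L\varepsilon^3\le\sigma^4R_0^2$, there is $N$ with $KT\le N\le2KT$ for which $(N,a)$ is admissible. -/

import Mathlib

open MeasureTheory ProbabilityTheory

noncomputable section

namespace ClippedSSTM

/-- `ℝⁿ` with the Euclidean norm. -/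
abbrev Euc (n : ℕ) := EuclideanSpace ℝ (Fin n)

/-- `f` is `L`-smooth: differentiable with `L`-Lipschitz gradient. -/
def LSmooth {n : ℕ} (f : Euc n → ℝ) (L : ℝ) : Prop :=
  Differentiable ℝ f ∧ ∀ x y, ‖gradient f x - gradient f y‖ ≤ L * ‖x - y‖

/-- `G x ζ`, with `ζ` distributed according to `P`, is an unbiased estimator of `∇ f x` whose
variance is at most `σ ^ 2` at every point `x`. -/
structure IsStochasticGradient {n : ℕ} {Ξ : Type*} [MeasurableSpace Ξ]
    (f : Euc n → ℝ) (P : Measure Ξ) (G : Euc n → Ξ → Euc n) (σ : ℝ) : Prop where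
  measurable : Measurable (Function.uncurry G)
  integrable : ∀ x, Integrable (G x) P
  unbiased : ∀ x, ∫ ζ, G x ζ ∂P = gradient f x
  integrable_sq : ∀ x, Integrable (fun ζ => ‖G x ζ - gradient f x‖ ^ 2) P
  variance_le : ∀ x, ∫ ζ, ‖G x ζ - gradient f x‖ ^ 2 ∂P ≤ σ ^ 2

/-- `ξ (k, i)`, for `k, i : ℕ`, are independent samples with common distribution `P`. -/
structure IsIIDSample {Ξ Ω : Type*} [MeasurableSpace Ξ] [MeasurableSpace Ω]
    (μ : Measure Ω) (P : Measure Ξ) (ξ : ℕ × ℕ → Ω → Ξ) : Prop where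
  measurable : ∀ p, Measurable (ξ p)
  map_eq : ∀ p, μ.map (ξ p) = P
  indep : iIndepFun ξ μ

/-- The stepsizes: `α 0 = 0` and `α (k + 1) = (k + 2) / (2 a L)`. -/
def stepα (a L : ℝ) : ℕ → ℝ
  | 0 => 0
  | k + 1 => ((k : ℝ) + 2) / (2 * a * L)

/-- `A 0 = 0` and `A (k + 1) = A k + α (k + 1)`. -/
def stepA (a L : ℝ) : ℕ → ℝ
  | 0 => 0
  | k + 1 => stepA a L k + stepα a L (k + 1)

/-- The clipping operator `clip(v, lam) = min {1, lam / ‖v‖} v`. -/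
def clip {n : ℕ} (v : Euc n) (lam : ℝ) : Euc n := min 1 (lam / ‖v‖) • v

/-- The mini-batch stochastic gradient at `x` computed from the samples `s 0, …, s (m - 1)`. -/
def miniBatch {n : ℕ} {Ξ : Type*} (G : Euc n → Ξ → Euc n) (x : Euc n) (m : ℕ) (s : ℕ → Ξ) :
    Euc n :=
  (m : ℝ)⁻¹ • ∑ i ∈ Finset.range m, G x (s i)

/-- The iterates `(y^k, z^k)` of `clipped-SSTM` started at `x₀`, with stepsize parameter `a`,
clipping parameter `B` and batchsizes `m k`, where iteration `k` uses the samples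
`s k 0, …, s k (m k - 1)`. -/
def iterates {n : ℕ} {Ξ : Type*} (G : Euc n → Ξ → Euc n) (x₀ : Euc n) (L a B : ℝ)
    (m : ℕ → ℕ) (s : ℕ → ℕ → Ξ) : ℕ → Euc n × Euc n
  | 0 => (x₀, x₀)
  | k + 1 =>
    let y := (iterates G x₀ L a B m s k).1
    let z := (iterates G x₀ L a B m s k).2
    let α := stepα a L (k + 1)
    let A := stepA a L k
    let A' := stepA a L (k + 1)
    let x := A'⁻¹ • (A • y + α • z)
    let g := clip (miniBatch G x (m k) (s k)) (B / α)
    let z' := z - α • g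
    (A'⁻¹ • (A • y + α • z'), z')

/-- `ln (4 N / β)`. -/
def logN (N : ℕ) (β : ℝ) : ℝ := Real.log (4 * (N : ℝ) / β)

/-- The lower bound on the stepsize parameter `a` (with `C = √5`). -/
def aMin (N : ℕ) (β : ℝ) : ℝ :=
  max 1 (max (16 * logN N β / √5)
    (36 * (2 * logN N β + √(4 * logN N β ^ 2 + 2 * logN N β)) ^ 2))

/-- The clipping parameter `B = C R₀ / (8 ln (4 N / β))`. -/
def clipB (N : ℕ) (β R₀ : ℝ) : ℝ := √5 * R₀ / (8 * logN N β)

/-- The real-valued batchsize formula at iteration `k`. -/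
def batchReal (L σ R₀ a : ℝ) (N : ℕ) (β : ℝ) (k : ℕ) : ℝ :=
  max 1 (max (6000 * σ ^ 2 * stepα a L (k + 1) ^ 2 * N * logN N β / (√5 ^ 2 * R₀ ^ 2))
    (10368 * σ ^ 2 * stepα a L (k + 1) ^ 2 * N / (√5 ^ 2 * R₀ ^ 2)))

/-- The number of samples drawn at iteration `k`: the batchsize formula, rounded up. -/
def batchSize (L σ R₀ a : ℝ) (N : ℕ) (β : ℝ) (k : ℕ) : ℕ := ⌈batchReal L σ R₀ a N β k⌉₊

/-- The total number of stochastic gradients computed in `N` iterations. -/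
def oracleCalls (L σ R₀ a : ℝ) (N : ℕ) (β : ℝ) : ℕ :=
  ∑ k ∈ Finset.range N, batchSize L σ R₀ a N β k

/-- The output `y^N` of `N` iterations of `clipped-SSTM`, as a function of the outcome `ω`. -/
def output {n : ℕ} {Ξ Ω : Type*} (G : Euc n → Ξ → Euc n) (ξ : ℕ × ℕ → Ω → Ξ) (x₀ : Euc n)
    (L σ R₀ a : ℝ) (N : ℕ) (β : ℝ) (ω : Ω) : Euc n :=
  (iterates G x₀ L a (clipB N β R₀) (batchSize L σ R₀ a N β) (fun k i => ξ (k, i) ω) N).1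

/-- The conditions on the number of iterations `N`, the confidence parameter `β` and the stepsize
parameter `a`. -/
def Admissible (N : ℕ) (β a : ℝ) : Prop := 1 ≤ N ∧ 2 ≤ logN N β ∧ aMin N β ≤ a

/-- Medium batches: `a = N ln (4 N / β)`. -/
def aMedium (N : ℕ) (β : ℝ) : ℝ := N * logN N β

/-- Constant batches: `a = a₀ N ^ (3 / 2) √(ln (4 N / β))`. -/
def aConst (a₀ : ℝ) (N : ℕ) (β : ℝ) : ℝ := a₀ * (N : ℝ) ^ (3 / 2 : ℝ) * √(logN N β)

end ClippedSSTM

end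

/-! ### Smooth convex functions, clipping, and the deterministic potential inequality -/

namespace ClippedSSTM

open scoped RealInnerProductSpace

variable {n : ℕ}

/-! Write `Φ_k = A_k (f y^k - f x^*) + ‖z^k - x^*‖² / 2`, and let `D` be the actual step `z^k -
z^{k+1}` minus the ideal step `α ∇f(x^{k+1})`. Acceleration gives `Φ_{k+1} ≤ Φ_k - ⟪D, z^k - x^*⟫ +
‖D‖²` (`potential_step`), so everything rests on controlling these errors along the trajectory.

Put `R = √5 R₀`. As long as `Φ_i ≤ R²/2` for all `i ≤ k`, the iterates lie in the ball of radius `R`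
around `x^*`, and the scaled gradient at the query point is at most `B/2`
(`norm_stepα_smul_gradient_le`). Clipping at `B` then changes a sample only by an amount quadratic
in its noise, while `D` stays bounded. Hence the error of one step, conditionally on the past, has
exponential moment at most `exp (κ v)`, with `v` a bound on the variance of the scaled mini-batch
gradient (`lintegral_exp_clip_error_le`).

Consequently `exp (s Φ_k)`, frozen at `exp (s R²/2)` once the threshold has been crossed, grows in
mean by at most `exp (κ v)` per step (`lintegral_stoppedExp_succ_le`). A single application of
Markov's inequality at time `N` controls the whole trajectory (`measure_not_stays_le`). On the good
event `A_N (f y^N - f x^*) ≤ R²/2`, which is the rate `10 a L R₀² / (N (N + 3))` of `output_gap_le`.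

The rest is calculus with logarithms: `mul_log_le_of_le` turns a lower bound on `N` in terms of `ε`
into one involving `log (4 N / β)`, which yields both accuracy and admissibility; `sq_div_log_le`
goes the other way for the oracle count with medium batches. -/

lemma hasDerivAt_comp_line {f : Euc n → ℝ} (hf : Differentiable ℝ f) (x d : Euc n) (t : ℝ) :
    HasDerivAt (fun s : ℝ => f (x + s • d)) ⟪gradient f (x + t • d), d⟫ t := by
  have h1 : HasDerivAt (fun s : ℝ => x + s • d) d t := by
    simpa using ((hasDerivAt_id t).smul_const d).const_add x
  have h2 := (hf (x + t • d)).hasFDerivAt.comp_hasDerivAt t h1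
  rwa [inner_gradient_left]

lemma add_inner_gradient_le {f : Euc n → ℝ} (hc : ConvexOn ℝ Set.univ f)
    (hf : Differentiable ℝ f) (x y : Euc n) : f x + ⟪gradient f x, y - x⟫ ≤ f y := by
  have h1 : ConvexOn ℝ Set.univ (fun s : ℝ => f (x + s • (y - x))) := by
    have := hc.comp_affineMap (AffineMap.lineMap (k := ℝ) x y)
    rw [Set.preimage_univ] at this
    refine this.congr fun s _ => ?_
    simp [AffineMap.lineMap_apply, add_comm]
  have h2 := h1.le_slope_of_hasDerivAt (Set.mem_univ (0 : ℝ)) (Set.mem_univ (1 : ℝ)) one_pos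
    (hasDerivAt_comp_line hf x (y - x) 0)
  simp [slope_def_field, -inner_gradient_left] at h2
  linarith

lemma LSmooth.le_add {f : Euc n → ℝ} {L : ℝ} (hf : LSmooth f L) (x d : Euc n) :
    f (x + d) ≤ f x + ⟪gradient f x, d⟫ + L / 2 * ‖d‖ ^ 2 := by
  -- The function minus its quadratic upper model along the segment has nonpositive derivative, by
  -- the Lipschitz bound on the gradient.
  have hd : ∀ t : ℝ, HasDerivAt
      (fun s : ℝ => f (x + s • d) - s * ⟪gradient f x, d⟫ - L / 2 * ‖d‖ ^ 2 * s ^ 2)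
      (⟪gradient f (x + t • d), d⟫ - ⟪gradient f x, d⟫ - L / 2 * ‖d‖ ^ 2 * (2 * t)) t := by
    intro t
    have h := ((hasDerivAt_comp_line hf.1 x d t).sub
      ((hasDerivAt_id t).mul_const ⟪gradient f x, d⟫)).sub
      ((hasDerivAt_pow 2 t).const_mul (L / 2 * ‖d‖ ^ 2))
    refine HasDerivAt.congr_deriv (f' := _) h ?_
    simp [-inner_gradient_left]
  have hanti : AntitoneOn
      (fun s : ℝ => f (x + s • d) - s * ⟪gradient f x, d⟫ - L / 2 * ‖d‖ ^ 2 * s ^ 2)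
      (Set.Icc 0 1) := by
    refine antitoneOn_of_deriv_nonpos (convex_Icc 0 1)
      (fun t _ => (hd t).continuousAt.continuousWithinAt)
      (fun t _ => (hd t).differentiableAt.differentiableWithinAt) fun t ht => ?_
    rw [interior_Icc] at ht
    rw [(hd t).deriv, ← inner_sub_left]
    have h1 := real_inner_le_norm (gradient f (x + t • d) - gradient f x) d
    have h2 := hf.2 (x + t • d) x
    rw [add_sub_cancel_left, norm_smul, Real.norm_eq_abs, abs_of_pos ht.1] at h2
    nlinarith [mul_le_mul_of_nonneg_right h2 (norm_nonneg d)]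
  have := hanti (Set.left_mem_Icc.2 zero_le_one) (Set.right_mem_Icc.2 zero_le_one) zero_le_one
  simp [-inner_gradient_left] at this
  linarith

/-- A gradient step of length `1 / L` lowers `f` by at least `‖∇f x‖² / (2 L)`, and cannot go below
the minimum. -/
lemma LSmooth.norm_gradient_sq_le {f : Euc n → ℝ} {L : ℝ} (hL : 0 < L) (hf : LSmooth f L)
    {xs : Euc n} (hxs : ∀ x, f xs ≤ f x) (x : Euc n) :
    ‖gradient f x‖ ^ 2 ≤ 2 * L * (f x - f xs) := by
  have h := hf.le_add x (-(L⁻¹ • gradient f x))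
  rw [inner_neg_right, inner_smul_right, real_inner_self_eq_norm_sq, norm_neg, norm_smul,
    Real.norm_eq_abs, abs_of_pos (inv_pos.2 hL)] at h
  have h3 := (hxs _).trans h
  have h4 : L / 2 * (L⁻¹ * ‖gradient f x‖) ^ 2 = L⁻¹ * ‖gradient f x‖ ^ 2 / 2 := by
    field_simp
  have h5 : L⁻¹ * ‖gradient f x‖ ^ 2 / 2 ≤ f x - f xs := by linarith
  have h6 := mul_le_mul_of_nonneg_left h5 (by positivity : 0 ≤ 2 * L)
  have h7 : 2 * L * (L⁻¹ * ‖gradient f x‖ ^ 2 / 2) = ‖gradient f x‖ ^ 2 := by field_simp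
  linarith

lemma LSmooth.gradient_eq_zero {f : Euc n → ℝ} {L : ℝ} (hL : 0 < L) (hf : LSmooth f L)
    {xs : Euc n} (hxs : ∀ x, f xs ≤ f x) : gradient f xs = 0 := by
  have h := hf.norm_gradient_sq_le hL hxs xs
  simp only [sub_self, mul_zero] at h
  have : ‖gradient f xs‖ = 0 := by nlinarith [norm_nonneg (gradient f xs)]
  simpa using this

lemma clip_of_norm_le {v : Euc n} {B : ℝ} (h : ‖v‖ ≤ B) : clip v B = v := by
  rcases eq_or_ne v 0 with rfl | hv
  · simp [clip]
  · have : 1 ≤ B / ‖v‖ := by rwa [one_le_div (norm_pos_iff.2 hv)]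
    simp [clip, min_eq_left this]

lemma clip_of_lt_norm {v : Euc n} {B : ℝ} (hB : 0 ≤ B) (h : B < ‖v‖) :
    clip v B = (B / ‖v‖) • v := by
  have : B / ‖v‖ ≤ 1 := by rw [div_le_one (hB.trans_lt h)]; exact h.le
  simp [clip, min_eq_right this]

lemma norm_clip_le {v : Euc n} {B : ℝ} (hB : 0 ≤ B) : ‖clip v B‖ ≤ B := by
  rcases le_or_gt ‖v‖ B with h | h
  · rwa [clip_of_norm_le h]
  · have hv : 0 < ‖v‖ := hB.trans_lt h
    rw [clip_of_lt_norm hB h, norm_smul, Real.norm_eq_abs, abs_of_nonneg (by positivity)]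
    rw [div_mul_cancel₀ _ hv.ne']

/-- Absorbing the stepsize makes the clipping level the same `B` in every iteration. -/
lemma smul_clip {v : Euc n} {α B : ℝ} (hα : 0 < α) : α • clip v (B / α) = clip (α • v) B := by
  simp only [clip, norm_smul, Real.norm_eq_abs, abs_of_pos hα, div_div, smul_smul]
  rw [mul_comm]

/-- Clipping does not increase the distance to a point of the ball. -/
lemma norm_clip_sub_le {v X : Euc n} {B : ℝ} (hB : 0 ≤ B) (hX : ‖X‖ ≤ B) :
    ‖clip v B - X‖ ≤ ‖v - X‖ := by
  rcases le_or_gt ‖v‖ B with h | h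
  · rw [clip_of_norm_le h]
  · have hv : 0 < ‖v‖ := hB.trans_lt h
    rw [clip_of_lt_norm hB h]
    set c := B / ‖v‖ with hc
    have hcv : c * ‖v‖ = B := by rw [hc, div_mul_cancel₀ _ hv.ne']
    have hc1 : c ≤ 1 := by rw [hc, div_le_one hv]; exact h.le
    have hc0 : 0 ≤ c := by positivity
    refine abs_le_of_sq_le_sq' ?_ (norm_nonneg _) |>.2
    rw [norm_sub_sq_real, norm_sub_sq_real, norm_smul, inner_smul_left, Real.norm_eq_abs,
      abs_of_nonneg hc0]
    have h1 := (real_inner_le_norm v X).trans (mul_le_mul_of_nonneg_left hX hv.le)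
    have h2 := mul_le_mul_of_nonneg_left h1 (sub_nonneg.2 hc1)
    simp only [conj_trivial]
    rw [hcv]
    nlinarith [mul_nonneg (sub_nonneg.2 hc1) (sub_nonneg.2 h.le), sq_nonneg (‖v‖ - B)]

/-- The error made by clipping is quadratic in the distance to a point of the half-sized ball. -/
lemma norm_clip_sub_self_le {v X : Euc n} {B : ℝ} (hB : 0 < B) (hX : ‖X‖ ≤ B / 2) :
    ‖clip v B - v‖ ≤ ‖v - X‖ ^ 2 / (2 * B) := by
  rcases le_or_gt ‖v‖ B with h | h
  · rw [clip_of_norm_le h]; simp; positivity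
  · have hv : 0 < ‖v‖ := hB.trans h
    have h1 : clip v B - v = -((1 - B / ‖v‖) • v) := by
      rw [clip_of_lt_norm hB.le h, sub_smul, one_smul]; abel
    have h2 : 0 ≤ 1 - B / ‖v‖ := by
      rw [sub_nonneg, div_le_one hv]; exact h.le
    rw [h1, norm_neg, norm_smul, Real.norm_eq_abs, abs_of_nonneg h2, sub_mul,
      div_mul_cancel₀ _ hv.ne', le_div_iff₀ (by positivity)]
    -- With `t = ‖v - X‖`, the excess `‖v‖ - B` is at most `t - B / 2`, and `2 B t - B² ≤ t²`.
    have h3 := norm_sub_norm_le v X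
    nlinarith [sq_nonneg (‖v - X‖ - B), norm_nonneg (v - X)]

/-- The potential decrease of one step, up to the error `D` of the clipped gradient step. -/
lemma potential_step {f : Euc n → ℝ} {L a A α A' : ℝ} (hL : 0 < L)
    (hc : ConvexOn ℝ Set.univ f) (hf : LSmooth f L) (ha : 2 ≤ a) (hA : 0 ≤ A) (hα : 0 < α)
    (hA' : A' = A + α) (hstep : a * L * α ^ 2 ≤ A') (y z xs x z' y' D : Euc n)
    (hx : x = A'⁻¹ • (A • y + α • z)) (hD : D = z - z' - α • gradient f x)
    (hy' : y' = A'⁻¹ • (A • y + α • z')) :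
    A' * (f y' - f xs) + ‖z' - xs‖ ^ 2 / 2 ≤
      A * (f y - f xs) + ‖z - xs‖ ^ 2 / 2 + (-⟪D, z - xs⟫ + ‖D‖ ^ 2) := by
  have hA'0 : 0 < A' := by linarith
  set g := gradient f x with hg
  set w := α • g with hw
  have hz' : z' = z - (w + D) := by rw [hD]; abel
  have hyx : y' = x + (-A'⁻¹ * α) • (w + D) := by
    rw [hy', hx, hz']; module
  have h1 := hf.le_add x ((-A'⁻¹ * α) • (w + D))
  rw [← hyx, inner_smul_right, norm_smul, Real.norm_eq_abs, mul_pow, sq_abs] at h1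
  have hgw : α * ⟪g, w + D⟫ = ⟪w, w + D⟫ := by rw [hw, inner_smul_left]; simp
  have h1' : A' * f y' ≤ A' * f x - ⟪w, w + D⟫ + ‖w + D‖ ^ 2 / (2 * a) := by
    have e1 : A' * (-A'⁻¹ * α * ⟪g, w + D⟫) = -⟪w, w + D⟫ := by
      rw [← hgw]; field_simp
    have e2 : A' * (L / 2 * ((-A'⁻¹ * α) ^ 2 * ‖w + D‖ ^ 2)) ≤ ‖w + D‖ ^ 2 / (2 * a) := by
      have : A' * (L / 2 * ((-A'⁻¹ * α) ^ 2 * ‖w + D‖ ^ 2)) =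
          (a * L * α ^ 2 / A') * (‖w + D‖ ^ 2 / (2 * a)) := by field_simp
      rw [this]
      exact mul_le_of_le_one_left (by positivity) ((div_le_one hA'0).2 hstep)
    have := mul_le_mul_of_nonneg_left h1 hA'0.le
    linarith
  have h2 := mul_le_mul_of_nonneg_left (add_inner_gradient_le hc hf.1 x y) hA
  have h3 := mul_le_mul_of_nonneg_left (add_inner_gradient_le hc hf.1 x xs) hα.le
  rw [← hg] at h2 h3
  -- The choice of `x` as the weighted mean of `y` and `z` is what makes the two convexity
  -- inequalities combine into a term in `z - xs`.
  have h4 : A * ⟪g, y - x⟫ + α * ⟪g, xs - x⟫ = -⟪w, z - xs⟫ := by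
    have e : A • (y - x) + α • (xs - x) = -(α • (z - xs)) := by
      have : A' • x = A • y + α • z := by rw [hx, smul_inv_smul₀ hA'0.ne']
      rw [hA', add_smul] at this
      have h5 : A • (y - x) + α • (xs - x) = A • y + α • xs - (A • x + α • x) := by module
      rw [h5, this]; module
    have := congrArg (fun u => ⟪g, u⟫) e
    simp only [inner_add_right, inner_smul_right, inner_neg_right] at this
    rw [hw, inner_smul_left]; simpa using this
  have h5 : ‖z' - xs‖ ^ 2 = ‖z - xs‖ ^ 2 - 2 * (⟪w, z - xs⟫ + ⟪D, z - xs⟫) + ‖w + D‖ ^ 2 := by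
    have : z' - xs = (z - xs) - (w + D) := by rw [hz']; abel
    rw [this, norm_sub_sq_real, real_inner_comm, inner_add_left]
  have h6 : ⟪w, w + D⟫ = ‖w‖ ^ 2 + ⟪w, D⟫ := by
    rw [inner_add_right, real_inner_self_eq_norm_sq]
  have h7 : ‖w + D‖ ^ 2 = ‖w‖ ^ 2 + 2 * ⟪w, D⟫ + ‖D‖ ^ 2 := norm_add_sq_real w D
  have h8 : ‖w + D‖ ^ 2 ≤ 2 * ‖w‖ ^ 2 + 2 * ‖D‖ ^ 2 := by
    nlinarith [norm_add_sq_real w D, norm_sub_sq_real w D, sq_nonneg ‖w - D‖]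
  -- This is where `a ≥ 2` enters. With this bound the `‖w‖²` and `⟪w, D⟫` terms coming from descent
  -- and from the distance expansion cancel exactly, leaving `‖D‖²`.
  have h9 : ‖w + D‖ ^ 2 / (2 * a) ≤ (‖w‖ ^ 2 + ‖D‖ ^ 2) / 2 := by
    rw [div_le_iff₀ (by linarith)]
    nlinarith [sq_nonneg ‖w‖, sq_nonneg ‖D‖]
  subst hA'
  nlinarith

end ClippedSSTM

/-! ### Exponential moment of the clipping error; moments of mini-batches -/

namespace ClippedSSTM

open scoped RealInnerProductSpace

variable {n : ℕ} {Ξ Ω : Type*} [MeasurableSpace Ξ] [MeasurableSpace Ω]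

/-- Exponential moment of the error of a clipped unbiased estimator. -/
lemma lintegral_exp_clip_error_le {μ : Measure Ω} [IsProbabilityMeasure μ] {Y : Ω → Euc n}
    {X d : Euc n} {v B R s : ℝ} (hi : Integrable Y μ) (hmean : ∫ ω, Y ω ∂μ = X)
    (hsq : Integrable (fun ω => ‖Y ω - X‖ ^ 2) μ) (hv : ∫ ω, ‖Y ω - X‖ ^ 2 ∂μ ≤ v)
    (hB : 0 < B) (hX : ‖X‖ ≤ B / 2) (hd : ‖d‖ ≤ R) (hBR : 16 * B ≤ R) (hs : 0 ≤ s)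
    (hsRB : s * R * B ≤ 3 / 8) :
    ∫⁻ ω, ENNReal.ofReal
        (Real.exp (s * (-⟪clip (Y ω) B - X, d⟫ + ‖clip (Y ω) B - X‖ ^ 2))) ∂μ ≤
      ENNReal.ofReal (Real.exp ((s * R / (2 * B) + s + 2 * s ^ 2 * R ^ 2) * v)) := by
  have hR : 0 < R := by linarith
  set κ := s * R / (2 * B) + s + 2 * s ^ 2 * R ^ 2 with hκ
  have hκ0 : 0 ≤ κ := by positivity
  have hpt : ∀ ω, Real.exp (s * (-⟪clip (Y ω) B - X, d⟫ + ‖clip (Y ω) B - X‖ ^ 2)) ≤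
      1 + κ * ‖Y ω - X‖ ^ 2 - s * ⟪d, Y ω - X⟫ := by
    intro ω
    set D := clip (Y ω) B - X with hD
    have hDle : ‖D‖ ≤ 3 / 2 * B := by
      have := (norm_sub_le (clip (Y ω) B) X).trans (add_le_add (norm_clip_le hB.le) hX)
      linarith
    have hDY : ‖D‖ ^ 2 ≤ ‖Y ω - X‖ ^ 2 :=
      pow_le_pow_left₀ (norm_nonneg _) (norm_clip_sub_le hB.le (by linarith)) 2
    have hin : |⟪D, d⟫| ≤ ‖D‖ * R :=
      (abs_real_inner_le_norm D d).trans (mul_le_mul_of_nonneg_left hd (norm_nonneg _))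
    -- `‖D‖ ≤ 3 B / 2 ≤ 3 R / 32`, so the quadratic term adds at most `3 / 32` to the factor `1` of
    -- the linear term.
    have hη : |-⟪D, d⟫ + ‖D‖ ^ 2| ≤ 35 / 32 * R * ‖D‖ := by
      refine (abs_add_le _ _).trans ?_
      rw [abs_neg, abs_of_nonneg (sq_nonneg ‖D‖)]
      nlinarith [norm_nonneg D]
    have hsη : |s * (-⟪D, d⟫ + ‖D‖ ^ 2)| ≤ 1 := by
      rw [abs_mul, abs_of_nonneg hs]
      have h1 := mul_le_mul_of_nonneg_left hη hs
      have h2 := mul_le_mul_of_nonneg_left hDle (mul_nonneg hs hR.le)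
      nlinarith
    -- `exp x ≤ 1 + x + x²` for `|x| ≤ 1`.
    have hexp := (abs_le.1 (Real.abs_exp_sub_one_sub_id_le hsη)).2
    have hsq' : (s * (-⟪D, d⟫ + ‖D‖ ^ 2)) ^ 2 ≤ 2 * s ^ 2 * R ^ 2 * ‖Y ω - X‖ ^ 2 := by
      have h1 : (-⟪D, d⟫ + ‖D‖ ^ 2) ^ 2 ≤ (35 / 32 * R * ‖D‖) ^ 2 := by
        rw [← sq_abs]; exact pow_le_pow_left₀ (abs_nonneg _) hη 2
      have h2 : (35 / 32 * R * ‖D‖) ^ 2 ≤ 2 * R ^ 2 * ‖Y ω - X‖ ^ 2 := by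
        have := mul_le_mul_of_nonneg_left hDY (sq_nonneg R)
        nlinarith [mul_nonneg (sq_nonneg R) (sq_nonneg ‖D‖)]
      have h3 := mul_le_mul_of_nonneg_left (h1.trans h2) (sq_nonneg s)
      nlinarith
    -- The linear term splits into the clipping error, which is quadratic in the noise, and the
    -- unclipped noise, which integrates to zero.
    have hbias : -⟪D, d⟫ ≤ R * (‖Y ω - X‖ ^ 2 / (2 * B)) - ⟪d, Y ω - X⟫ := by
      have e : ⟪D, d⟫ = ⟪clip (Y ω) B - Y ω, d⟫ + ⟪d, Y ω - X⟫ := by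
        rw [real_inner_comm (Y ω - X) d, ← inner_add_left, hD]; congr 1; abel
      have h1 := abs_real_inner_le_norm (clip (Y ω) B - Y ω) d
      have h2 := mul_le_mul (norm_clip_sub_self_le hB hX (v := Y ω)) hd (norm_nonneg _)
        (by positivity)
      have h3 := neg_abs_le ⟪clip (Y ω) B - Y ω, d⟫
      linarith
    have h4 := mul_le_mul_of_nonneg_left hbias hs
    have h5 := mul_le_mul_of_nonneg_left hDY hs
    have e5 : κ * ‖Y ω - X‖ ^ 2 = s * (R * (‖Y ω - X‖ ^ 2 / (2 * B))) + s * ‖Y ω - X‖ ^ 2 +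
        2 * s ^ 2 * R ^ 2 * ‖Y ω - X‖ ^ 2 := by rw [hκ]; ring
    linarith
  have hiX : Integrable (fun ω => Y ω - X) μ := hi.sub (integrable_const X)
  have hin : Integrable (fun ω => ⟪d, Y ω - X⟫) μ := hiX.const_inner d
  have hH1 : Integrable (fun ω => 1 + κ * ‖Y ω - X‖ ^ 2) μ :=
    (integrable_const 1).add (hsq.const_mul κ)
  have hH : Integrable (fun ω => 1 + κ * ‖Y ω - X‖ ^ 2 - s * ⟪d, Y ω - X⟫) μ :=
    hH1.sub (hin.const_mul s)
  refine (lintegral_mono fun ω => ENNReal.ofReal_le_ofReal (hpt ω)).trans ?_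
  rw [← ofReal_integral_eq_lintegral_ofReal hH
    (Filter.Eventually.of_forall fun ω => (Real.exp_pos _).le.trans (hpt ω))]
  refine ENNReal.ofReal_le_ofReal ?_
  rw [integral_sub hH1 (hin.const_mul s), integral_add (integrable_const 1) (hsq.const_mul κ),
    integral_const_mul, integral_const_mul, integral_inner hiX,
    integral_sub hi (integrable_const X), hmean]
  simp only [integral_const, probReal_univ, one_smul, sub_self, inner_zero_right, mul_zero,
    sub_zero]
  have := mul_le_mul_of_nonneg_left hv hκ0
  linarith [Real.add_one_le_exp (κ * v)]

/-- The second moment of a sum of independent centred vectors is the sum of second moments. -/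
lemma integral_norm_sum_sq {μ : Measure Ω} [IsProbabilityMeasure μ] {w : ℕ → Ω → Euc n}
    (hind : iIndepFun w μ) (hi : ∀ i, Integrable (w i) μ) (hmean : ∀ i, ∫ ω, w i ω ∂μ = 0)
    (hsq : ∀ i, Integrable (fun ω => ‖w i ω‖ ^ 2) μ) (m : ℕ) :
    Integrable (fun ω => ‖∑ i ∈ Finset.range m, w i ω‖ ^ 2) μ ∧
      ∫ ω, ‖∑ i ∈ Finset.range m, w i ω‖ ^ 2 ∂μ =
        ∑ i ∈ Finset.range m, ∫ ω, ‖w i ω‖ ^ 2 ∂μ := by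
  have hint : ∀ i j, Integrable (fun ω => ⟪w i ω, w j ω⟫) μ := by
    intro i j
    rcases eq_or_ne i j with rfl | hij
    · simpa only [real_inner_self_eq_norm_sq] using hsq i
    · exact (hind.indepFun hij).integrable_bilin (hi i) (hi j) (innerSL ℝ)
  have hzero : ∀ i j, i ≠ j → ∫ ω, ⟪w i ω, w j ω⟫ ∂μ = 0 := by
    intro i j hij
    have := (hind.indepFun hij).integral_bilin (hi i) (hi j) (innerSL ℝ)
    rw [hmean i] at this
    exact this.trans (by simp)
  have e : (fun ω => ‖∑ i ∈ Finset.range m, w i ω‖ ^ 2) =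
      fun ω => ∑ i ∈ Finset.range m, ∑ j ∈ Finset.range m, ⟪w i ω, w j ω⟫ := by
    funext ω
    rw [← real_inner_self_eq_norm_sq, sum_inner]
    exact Finset.sum_congr rfl fun i _ => inner_sum _ _ _
  have hint' : ∀ i, Integrable (fun ω => ∑ j ∈ Finset.range m, ⟪w i ω, w j ω⟫) μ :=
    fun i => integrable_finsetSum _ fun j _ => hint i j
  rw [e]
  refine ⟨integrable_finsetSum _ fun i _ => hint' i, ?_⟩
  rw [integral_finsetSum _ fun i _ => hint' i]
  refine Finset.sum_congr rfl fun i hi' => ?_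
  rw [integral_finsetSum _ fun j _ => hint i j, Finset.sum_eq_single_of_mem i hi'
    fun j _ hj => hzero i j hj.symm]
  simp only [real_inner_self_eq_norm_sq]

lemma IsStochasticGradient.measurable_right {f : Euc n → ℝ} {P : Measure Ξ}
    {G : Euc n → Ξ → Euc n} {σ : ℝ} (hG : IsStochasticGradient f P G σ) (x : Euc n) :
    Measurable (G x) :=
  hG.measurable.comp (measurable_const.prodMk measurable_id)

/-- Mean and variance of the mini-batch stochastic gradient. -/
lemma IsStochasticGradient.miniBatch_moments {f : Euc n → ℝ} {P : Measure Ξ}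
    {G : Euc n → Ξ → Euc n} {σ : ℝ} (hG : IsStochasticGradient f P G σ)
    {μ : Measure Ω} [IsProbabilityMeasure μ] {ζ : ℕ → Ω → Ξ} (hζ : ∀ i, Measurable (ζ i))
    (hmap : ∀ i, μ.map (ζ i) = P) (hind : iIndepFun ζ μ) (x : Euc n) {m : ℕ} (hm : 0 < m) :
    Integrable (fun ω => miniBatch G x m (fun i => ζ i ω)) μ ∧
      ∫ ω, miniBatch G x m (fun i => ζ i ω) ∂μ = gradient f x ∧
      Integrable (fun ω => ‖miniBatch G x m (fun i => ζ i ω) - gradient f x‖ ^ 2) μ ∧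
      ∫ ω, ‖miniBatch G x m (fun i => ζ i ω) - gradient f x‖ ^ 2 ∂μ ≤ σ ^ 2 / m := by
  have hGm := hG.measurable_right x
  have hm' : (0 : ℝ) < m := Nat.cast_pos.2 hm
  have hi : ∀ i, Integrable (fun ω => G x (ζ i ω)) μ := fun i => by
    have := hG.integrable x
    rw [← hmap i] at this
    exact this.comp_measurable (hζ i)
  have hmean : ∀ i, ∫ ω, G x (ζ i ω) ∂μ = gradient f x := fun i => by
    rw [← hG.unbiased x, ← hmap i, integral_map (hζ i).aemeasurable hGm.aestronglyMeasurable]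
  have hwm : Measurable fun ζ => G x ζ - gradient f x := hGm.sub measurable_const
  have hw : iIndepFun (fun i ω => G x (ζ i ω) - gradient f x) μ :=
    hind.comp (fun _ ζ => G x ζ - gradient f x) fun _ => hwm
  have hwi : ∀ i, Integrable (fun ω => G x (ζ i ω) - gradient f x) μ :=
    fun i => (hi i).sub (integrable_const _)
  have hw0 : ∀ i, ∫ ω, (G x (ζ i ω) - gradient f x) ∂μ = 0 := fun i => by
    rw [integral_sub (hi i) (integrable_const _), hmean i]; simp
  have hwsq : ∀ i, Integrable (fun ω => ‖G x (ζ i ω) - gradient f x‖ ^ 2) μ := fun i => by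
    have := hG.integrable_sq x
    rw [← hmap i] at this
    exact this.comp_measurable (hζ i)
  have hwv : ∀ i, ∫ ω, ‖G x (ζ i ω) - gradient f x‖ ^ 2 ∂μ ≤ σ ^ 2 := fun i => by
    have := hG.variance_le x
    rwa [← hmap i, integral_map (hζ i).aemeasurable
      (hwm.norm.pow_const 2).aestronglyMeasurable] at this
  obtain ⟨h1, h2⟩ := integral_norm_sum_sq hw hwi hw0 hwsq m
  have e : ∀ ω, ‖miniBatch G x m (fun i => ζ i ω) - gradient f x‖ ^ 2 =
      ((m : ℝ)⁻¹) ^ 2 * ‖∑ i ∈ Finset.range m, (G x (ζ i ω) - gradient f x)‖ ^ 2 := by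
    intro ω
    rw [← mul_pow, ← abs_of_pos (inv_pos.2 hm'), ← Real.norm_eq_abs, ← norm_smul]
    congr 2
    rw [Finset.sum_sub_distrib, smul_sub, Finset.sum_const, Finset.card_range,
      ← Nat.cast_smul_eq_nsmul ℝ, smul_smul,
      inv_mul_cancel₀ hm'.ne', one_smul, miniBatch]
  have hS : Integrable (fun ω => ∑ i ∈ Finset.range m, G x (ζ i ω)) μ :=
    integrable_finsetSum _ fun i _ => hi i
  refine ⟨hS.smul (m : ℝ)⁻¹, ?_, ?_, ?_⟩
  · simp only [miniBatch]
    rw [integral_smul, integral_finsetSum _ fun i _ => hi i, Finset.sum_congr rfl fun i _ => hmean i,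
      Finset.sum_const, Finset.card_range, ← Nat.cast_smul_eq_nsmul ℝ, smul_smul,
      inv_mul_cancel₀ hm'.ne', one_smul]
  · simp only [e]; exact h1.const_mul _
  · simp only [e]
    rw [integral_const_mul, h2]
    calc ((m : ℝ)⁻¹) ^ 2 * ∑ i ∈ Finset.range m, ∫ ω, ‖G x (ζ i ω) - gradient f x‖ ^ 2 ∂μ
        ≤ ((m : ℝ)⁻¹) ^ 2 * ∑ i ∈ Finset.range m, σ ^ 2 := by
          gcongr with i _; exact hwv i
      _ = σ ^ 2 / m := by
          rw [Finset.sum_const, Finset.card_range, nsmul_eq_mul]; field_simp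

lemma measurable_clip (B : ℝ) : Measurable fun v : Euc n => clip v B := by
  unfold clip
  exact (measurable_const.min (measurable_const.div measurable_norm)).smul measurable_id

end ClippedSSTM

/-! ### Stepsizes, the iteration as a map of state and samples, and its conditional one-step bound
-/

namespace ClippedSSTM

open scoped RealInnerProductSpace

variable {n : ℕ}

lemma stepA_eq (a L : ℝ) (k : ℕ) : stepA a L k = (k : ℝ) * (k + 3) / (4 * a * L) := by
  induction k with
  | zero => simp [stepA]
  | succ k ih =>
    rw [stepA, ih, stepα]
    rcases eq_or_ne (a * L) 0 with h | h
    · simp [mul_assoc, h]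
    · have ha : a ≠ 0 := left_ne_zero_of_mul h
      have hL : L ≠ 0 := right_ne_zero_of_mul h
      push_cast
      field_simp
      ring

lemma stepα_succ_pos {a L : ℝ} (ha : 0 < a) (hL : 0 < L) (k : ℕ) : 0 < stepα a L (k + 1) := by
  rw [stepα]; positivity

lemma stepA_nonneg {a L : ℝ} (ha : 0 < a) (hL : 0 < L) (k : ℕ) : 0 ≤ stepA a L k := by
  rw [stepA_eq]; positivity

/-- It amounts to `(k + 2)² ≤ (k + 1) (k + 4)`, and is the stepsize condition of `potential_step`.
-/
lemma mul_stepα_sq_le {a L : ℝ} (ha : 0 < a) (hL : 0 < L) (k : ℕ) :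
    a * L * stepα a L (k + 1) ^ 2 ≤ stepA a L (k + 1) := by
  rw [stepA_eq, stepα]
  have h : a * L * (((k : ℝ) + 2) / (2 * a * L)) ^ 2 = ((k : ℝ) + 2) ^ 2 / (4 * a * L) := by
    field_simp; norm_num
  rw [h]
  gcongr
  push_cast
  nlinarith [(Nat.cast_nonneg k : (0 : ℝ) ≤ k)]

/-- The point at which the stochastic gradient is evaluated at iteration `k`. -/
noncomputable def queryPoint (L a : ℝ) (k : ℕ) (p : Euc n × Euc n) : Euc n :=
  (stepA a L (k + 1))⁻¹ • (stepA a L k • p.1 + stepα a L (k + 1) • p.2)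

/-- One iteration, from the state `p = (y^k, z^k)` and the samples `b`. -/
noncomputable def stepState {Ξ : Type*} (G : Euc n → Ξ → Euc n) (L a B : ℝ) (m : ℕ → ℕ) (k : ℕ)
    (p : Euc n × Euc n) (b : ℕ → Ξ) : Euc n × Euc n :=
  let z' := p.2 - stepα a L (k + 1) •
    clip (miniBatch G (queryPoint L a k p) (m k) b) (B / stepα a L (k + 1))
  ((stepA a L (k + 1))⁻¹ • (stepA a L k • p.1 + stepα a L (k + 1) • z'), z')

lemma iterates_succ {Ξ : Type*} (G : Euc n → Ξ → Euc n) (x₀ : Euc n) (L a B : ℝ) (m : ℕ → ℕ)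
    (s : ℕ → ℕ → Ξ) (k : ℕ) :
    iterates G x₀ L a B m s (k + 1) = stepState G L a B m k (iterates G x₀ L a B m s k) (s k) :=
  rfl

lemma measurable_stepState {Ξ : Type*} [MeasurableSpace Ξ] {G : Euc n → Ξ → Euc n} (hG : Measurable (Function.uncurry G))
    (L a B : ℝ) (m : ℕ → ℕ) (k : ℕ) :
    Measurable fun q : (Euc n × Euc n) × (ℕ → Ξ) => stepState G L a B m k q.1 q.2 := by
  have hx : Measurable fun q : (Euc n × Euc n) × (ℕ → Ξ) => queryPoint L a k q.1 := by
    unfold queryPoint; fun_prop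
  have hg : Measurable fun q : (Euc n × Euc n) × (ℕ → Ξ) =>
      miniBatch G (queryPoint L a k q.1) (m k) q.2 := by
    have hi : ∀ i, Measurable fun q : (Euc n × Euc n) × (ℕ → Ξ) =>
        G (queryPoint L a k q.1) (q.2 i) := fun i =>
      hG.comp (hx.prodMk ((measurable_pi_apply i).comp measurable_snd))
    unfold miniBatch
    fun_prop
  have hgc : Measurable fun q : (Euc n × Euc n) × (ℕ → Ξ) =>
      clip (miniBatch G (queryPoint L a k q.1) (m k) q.2) (B / stepα a L (k + 1)) :=
    (measurable_clip _).comp hg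
  have hz : Measurable fun q : (Euc n × Euc n) × (ℕ → Ξ) => q.1.2 - stepα a L (k + 1) •
      clip (miniBatch G (queryPoint L a k q.1) (m k) q.2) (B / stepα a L (k + 1)) :=
    by fun_prop
  unfold stepState
  exact Measurable.prodMk (by fun_prop) hz

lemma measurable_iterates {Ξ Ω : Type*} [MeasurableSpace Ξ] [MeasurableSpace Ω] {G : Euc n → Ξ → Euc n} (hG : Measurable (Function.uncurry G))
    (x₀ : Euc n) (L a B : ℝ) (m : ℕ → ℕ) (k : ℕ) {ξ : ℕ × ℕ → Ω → Ξ}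
    (hξ : ∀ p : ℕ × ℕ, p.1 < k → Measurable (ξ p)) :
    Measurable fun ω => iterates G x₀ L a B m (fun j i => ξ (j, i) ω) k := by
  induction k with
  | zero => exact measurable_const
  | succ k ih =>
    simp only [iterates_succ]
    have h : Measurable fun ω =>
        (iterates G x₀ L a B m (fun j i => ξ (j, i) ω) k, fun i => ξ (k, i) ω) :=
      (ih fun p hp => hξ p (hp.trans k.lt_succ_self)).prodMk
        (measurable_pi_lambda _ fun i => hξ (k, i) k.lt_succ_self)
    simpa only [Function.comp_def] using Measurable.comp (measurable_stepState hG L a B m k) h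

/-- The potential `A_k (f y^k - f x^*) + ‖z^k - x^*‖² / 2`. -/
noncomputable def potential (f : Euc n → ℝ) (xs : Euc n) (L a : ℝ) (k : ℕ)
    (p : Euc n × Euc n) : ℝ :=
  stepA a L k * (f p.1 - f xs) + ‖p.2 - xs‖ ^ 2 / 2

lemma measurable_potential {f : Euc n → ℝ} (hf : Continuous f) (xs : Euc n) (L a : ℝ) (k : ℕ) :
    Measurable (potential f xs L a k) := by
  unfold potential
  have := hf.measurable
  fun_prop

/-- Scaled gradients are small at the points where they are queried. -/
lemma norm_stepα_smul_gradient_le {f : Euc n → ℝ} {L a R : ℝ} {xs : Euc n} (hL : 0 < L)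
    (ha : 0 < a) (hR : 0 ≤ R) (hf : LSmooth f L) (hxs : ∀ x, f xs ≤ f x) (k : ℕ)
    (p : Euc n × Euc n) (hy : ‖p.1 - xs‖ ≤ R) (hpot : potential f xs L a k p ≤ R ^ 2 / 2) :
    ‖stepα a L (k + 1) • gradient f (queryPoint L a k p)‖ ≤ R * (2 / a + 3 / (2 * √a)) := by
  obtain ⟨y, z⟩ := p
  simp only [potential] at hy hpot
  have hA := stepA_nonneg ha hL k
  have hα := stepα_succ_pos ha hL k
  have hgap : 0 ≤ f y - f xs := sub_nonneg.2 (hxs y)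
  have hz : ‖z - xs‖ ≤ R := by
    refine abs_le_of_sq_le_sq' ?_ hR |>.2
    nlinarith [mul_nonneg hA hgap]
  have hsa : 0 < √a := Real.sqrt_pos.2 ha
  rw [norm_smul, Real.norm_eq_abs, abs_of_pos hα]
  -- `A_0 = 0` says nothing about the gap at `y^0`, so the first query is compared directly with the
  -- minimizer; later ones go through `y^k`, whose gradient is controlled by the gap.
  rcases Nat.eq_zero_or_pos k with rfl | hk
  · have hx : queryPoint L a 0 (y, z) = z := by
      simp only [queryPoint, stepA, zero_smul, zero_add]
      rw [inv_smul_smul₀ hα.ne']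
    have h1 := hf.2 z xs
    rw [hf.gradient_eq_zero hL hxs, sub_zero] at h1
    rw [hx]
    have h2 : stepα a L (0 + 1) * L = 1 / a := by
      rw [stepα]; field_simp; simp
    calc stepα a L (0 + 1) * ‖gradient f z‖ ≤ stepα a L (0 + 1) * (L * R) := by
          gcongr; exact h1.trans (by gcongr)
      _ = R * (1 / a) := by rw [← mul_assoc, h2]; ring
      _ ≤ R * (2 / a + 3 / (2 * √a)) := by
          gcongr
          have : 1 / a ≤ 2 / a := by gcongr; norm_num
          have : 0 ≤ 3 / (2 * √a) := by positivity
          linarith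
  · set A := stepA a L k with hAdef
    set α := stepα a L (k + 1) with hαdef
    have hA' : stepA a L (k + 1) = A + α := rfl
    have hk' : (1 : ℝ) ≤ k := by exact_mod_cast hk
    have hApos : 0 < A := by rw [hAdef, stepA_eq]; positivity
    have hA'pos : 0 < A + α := by linarith
    have hxy : queryPoint L a k (y, z) - y = (α / (A + α)) • (z - y) := by
      simp only [queryPoint]
      rw [hA', ← hAdef, ← hαdef, div_eq_inv_mul, mul_smul, ← smul_right_injective _ hA'pos.ne' |>.eq_iff]
      simp only [smul_sub, smul_inv_smul₀ hA'pos.ne']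
      module
    have hzy : ‖z - y‖ ≤ 2 * R := by
      have : z - y = (z - xs) - (y - xs) := by abel
      rw [this]; exact (norm_sub_le _ _).trans (by linarith)
    have h1 : ‖gradient f (queryPoint L a k (y, z))‖ ≤
        L * (α / (A + α) * (2 * R)) + ‖gradient f y‖ := by
      have h := hf.2 (queryPoint L a k (y, z)) y
      rw [hxy, norm_smul, Real.norm_eq_abs, abs_of_pos (by positivity)] at h
      have h' := norm_sub_norm_le (gradient f (queryPoint L a k (y, z))) (gradient f y)
      have : L * (α / (A + α) * ‖z - y‖) ≤ L * (α / (A + α) * (2 * R)) := by gcongr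
      linarith
    have h2 : α * (L * (α / (A + α) * (2 * R))) ≤ R * (2 / a) := by
      have h := mul_stepα_sq_le ha hL k
      rw [hA', ← hαdef] at h
      have e : α * (L * (α / (A + α) * (2 * R))) = (a * L * α ^ 2 / (A + α)) * (R * (2 / a)) := by
        field_simp
      rw [e]
      exact mul_le_of_le_one_left (by positivity) ((div_le_one hA'pos).2 h)
    have h3 : α * ‖gradient f y‖ ≤ R * (3 / (2 * √a)) := by
      refine abs_le_of_sq_le_sq' ?_ (by positivity) |>.2
      have hg := hf.norm_gradient_sq_le hL hxs y
      have hgap' : f y - f xs ≤ R ^ 2 / (2 * A) := by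
        rw [le_div_iff₀ (by positivity)]
        nlinarith [sq_nonneg ‖z - xs‖]
      -- The left side is `(k + 2)² / (a k (k + 3))`, which is largest at `k = 1`.
      have hratio : L * α ^ 2 / A ≤ 9 / (4 * a) := by
        rw [hAdef, hαdef, stepA_eq, stepα, div_le_div_iff₀ (by positivity) (by positivity)]
        have e1 : L * (((k : ℝ) + 2) / (2 * a * L)) ^ 2 * (4 * a) = ((k : ℝ) + 2) ^ 2 / (a * L) := by
          field_simp; norm_num
        have e2 : 9 * ((k : ℝ) * (k + 3) / (4 * a * L)) = 9 * (k * (k + 3)) / 4 / (a * L) := by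
          field_simp
        rw [e1, e2]
        gcongr
        nlinarith
      have e3 : (R * (3 / (2 * √a))) ^ 2 = R ^ 2 * (9 / (4 * a)) := by
        rw [mul_pow, div_pow, mul_pow, Real.sq_sqrt ha.le]; norm_num
      rw [e3, mul_pow]
      calc α ^ 2 * ‖gradient f y‖ ^ 2 ≤ α ^ 2 * (2 * L * (R ^ 2 / (2 * A))) := by
            gcongr; exact hg.trans (by gcongr)
        _ = R ^ 2 * (L * α ^ 2 / A) := by field_simp
        _ ≤ R ^ 2 * (9 / (4 * a)) := by gcongr
    calc α * ‖gradient f (queryPoint L a k (y, z))‖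
        ≤ α * (L * (α / (A + α) * (2 * R)) + ‖gradient f y‖) := by gcongr
      _ ≤ R * (2 / a + 3 / (2 * √a)) := by rw [mul_add, mul_add]; exact add_le_add h2 h3

/-- If the `z`-iterates stay in a ball around `x^*`, so do the `y`-iterates. -/
lemma norm_iterates_fst_sub_le {Ξ : Type*} {G : Euc n → Ξ → Euc n} {x₀ xs : Euc n} {L a B R : ℝ}
    (hL : 0 < L) (ha : 0 < a) (m : ℕ → ℕ) (s : ℕ → ℕ → Ξ) (k : ℕ)
    (hz : ∀ i ≤ k, ‖(iterates G x₀ L a B m s i).2 - xs‖ ≤ R) :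
    ‖(iterates G x₀ L a B m s k).1 - xs‖ ≤ R := by
  induction k with
  | zero => exact hz 0 le_rfl
  | succ k ih =>
    have h1 := ih fun i hi => hz i (hi.trans k.le_succ)
    have h2 := hz (k + 1) le_rfl
    have hA := stepA_nonneg ha hL k
    have hα := stepα_succ_pos ha hL k
    have hA' : stepA a L (k + 1) = stepA a L k + stepα a L (k + 1) := rfl
    have hA'pos : 0 < stepA a L (k + 1) := by rw [hA']; linarith
    have e : (iterates G x₀ L a B m s (k + 1)).1 = (stepA a L (k + 1))⁻¹ •
        (stepA a L k • (iterates G x₀ L a B m s k).1 +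
          stepα a L (k + 1) • (iterates G x₀ L a B m s (k + 1)).2) := rfl
    have e2 : (iterates G x₀ L a B m s (k + 1)).1 - xs = (stepA a L (k + 1))⁻¹ •
        (stepA a L k • ((iterates G x₀ L a B m s k).1 - xs) +
          stepα a L (k + 1) • ((iterates G x₀ L a B m s (k + 1)).2 - xs)) := by
      rw [e, ← smul_right_injective _ hA'pos.ne' |>.eq_iff]
      simp only [smul_sub, smul_inv_smul₀ hA'pos.ne']
      rw [hA']
      module
    rw [e2, norm_smul, norm_inv, Real.norm_eq_abs, abs_of_pos hA'pos, inv_mul_le_iff₀ hA'pos]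
    refine (norm_add_le _ _).trans ?_
    rw [norm_smul, norm_smul, Real.norm_eq_abs, Real.norm_eq_abs, abs_of_nonneg hA, abs_of_pos hα,
      hA', add_mul]
    gcongr

/-- Conditional exponential growth of the potential over one iteration. -/
lemma lintegral_exp_potential_stepState_le {Ξ Ω : Type*} [MeasurableSpace Ξ] [MeasurableSpace Ω] {f : Euc n → ℝ} {P : Measure Ξ}
    {G : Euc n → Ξ → Euc n} {L σ a B R s v : ℝ} {xs : Euc n} {μ : Measure Ω}
    [IsProbabilityMeasure μ] {ζ : ℕ → Ω → Ξ} (hL : 0 < L) (hc : ConvexOn ℝ Set.univ f)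
    (hf : LSmooth f L) (hG : IsStochasticGradient f P G σ) (hζ : ∀ i, Measurable (ζ i))
    (hmap : ∀ i, μ.map (ζ i) = P) (hind : iIndepFun ζ μ) (hxs : ∀ x, f xs ≤ f x)
    (ha : 2 ≤ a) (hB : 0 < B) (hBR : 16 * B ≤ R) (hs : 0 ≤ s) (hsRB : s * R * B ≤ 3 / 8)
    (haB : R * (2 / a + 3 / (2 * √a)) ≤ B / 2) (m : ℕ → ℕ) (k : ℕ) (hm : 0 < m k)
    (hv : stepα a L (k + 1) ^ 2 * σ ^ 2 / m k ≤ v) (p : Euc n × Euc n) (hy : ‖p.1 - xs‖ ≤ R)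
    (hpot : potential f xs L a k p ≤ R ^ 2 / 2) :
    ∫⁻ ω, ENNReal.ofReal (Real.exp (s * potential f xs L a (k + 1)
        (stepState G L a B m k p fun i => ζ i ω))) ∂μ ≤
      ENNReal.ofReal (Real.exp ((s * R / (2 * B) + s + 2 * s ^ 2 * R ^ 2) * v)) *
        ENNReal.ofReal (Real.exp (s * potential f xs L a k p)) := by
  have ha0 : 0 < a := by linarith
  have hR : 0 ≤ R := by linarith
  have hα := stepα_succ_pos ha0 hL k
  set α := stepα a L (k + 1) with hαdef
  set x := queryPoint L a k p with hx
  set g : Ω → Euc n := fun ω => miniBatch G x (m k) fun i => ζ i ω with hg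
  obtain ⟨h1, h2, h3, h4⟩ := hG.miniBatch_moments hζ hmap hind x hm
  have hX := (norm_stepα_smul_gradient_le hL ha0 hR hf hxs k p hy hpot).trans haB
  have hz : ‖p.2 - xs‖ ≤ R := by
    refine abs_le_of_sq_le_sq' ?_ hR |>.2
    simp only [potential] at hpot
    nlinarith [mul_nonneg (stepA_nonneg ha0 hL k) (sub_nonneg.2 (hxs p.1))]
  have hpt : ∀ ω, ENNReal.ofReal (Real.exp (s * potential f xs L a (k + 1)
        (stepState G L a B m k p fun i => ζ i ω))) ≤
      ENNReal.ofReal (Real.exp (s * potential f xs L a k p)) *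
      ENNReal.ofReal (Real.exp (s * (-⟪clip (α • g ω) B - α • gradient f x, p.2 - xs⟫ +
        ‖clip (α • g ω) B - α • gradient f x‖ ^ 2))) := by
    intro ω
    rw [← ENNReal.ofReal_mul (Real.exp_pos _).le, ← Real.exp_add, ← mul_add]
    refine ENNReal.ofReal_le_ofReal (Real.exp_le_exp.2 (mul_le_mul_of_nonneg_left ?_ hs))
    refine potential_step (y := p.1) (z := p.2) (x := x) hL hc hf ha (stepA_nonneg ha0 hL k) hα rfl
      (mul_stepα_sq_le ha0 hL k) _ _ _ _ rfl ?_ rfl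
    rw [← smul_clip hα]
    simp only [stepState, ← hαdef, ← hx, hg]
    module
  refine (lintegral_mono hpt).trans ?_
  rw [lintegral_const_mul' _ _ ENNReal.ofReal_ne_top, mul_comm]
  refine mul_le_mul_left ?_ _
  have e : ∀ ω, ‖α • g ω - α • gradient f x‖ ^ 2 = α ^ 2 * ‖g ω - gradient f x‖ ^ 2 := fun ω => by
    rw [← smul_sub, norm_smul, mul_pow, Real.norm_eq_abs, sq_abs]
  have hi : Integrable (fun ω => α • g ω) μ := h1.smul α
  refine lintegral_exp_clip_error_le hi ?_ ?_ ?_ hB hX hz hBR hs hsRB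
  · rw [integral_smul, h2]
  · refine (h3.const_mul (α ^ 2)).congr (Filter.Eventually.of_forall fun ω => (e ω).symm)
  · rw [integral_congr_ae (Filter.Eventually.of_forall e), integral_const_mul]
    refine le_trans (mul_le_mul_of_nonneg_left h4 (sq_nonneg α)) ?_
    rwa [← mul_div_assoc]

end ClippedSSTM

/-! ### The stopped exponential process and the maximal inequality -/

namespace ClippedSSTM

open scoped RealInnerProductSpace

variable {n : ℕ} {Ξ Ω : Type*} [MeasurableSpace Ω]

/-- Fubini for an independent pair, with the inner integral again over `Ω`. It plays the role of
conditioning on `X`: the one-step bound holds for a fixed state, and applies pointwise in `ω`. -/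
lemma lintegral_comp_of_indepFun {α β : Type*} [MeasurableSpace α] [MeasurableSpace β]
    {μ : Measure Ω} [IsProbabilityMeasure μ] {X : Ω → α} {Y : Ω → β} (hX : Measurable X)
    (hY : Measurable Y) (hXY : IndepFun X Y μ) {h : α × β → ENNReal} (hh : Measurable h) :
    ∫⁻ ω, h (X ω, Y ω) ∂μ = ∫⁻ ω, ∫⁻ ω', h (X ω, Y ω') ∂μ ∂μ := by
  have hYp : IsProbabilityMeasure (μ.map Y) := Measure.isProbabilityMeasure_map hY.aemeasurable
  rw [← lintegral_map (f := h) (g := fun ω => (X ω, Y ω)) hh (hX.prodMk hY),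
    hXY.map_prod_eq_prod_map_map hX.aemeasurable hY.aemeasurable, lintegral_prod _ hh.aemeasurable,
    lintegral_map hh.lintegral_prod_right' hX]
  refine lintegral_congr fun ω => ?_
  exact lintegral_map (hh.comp measurable_prodMk_left) hY

/-- Samples of iteration `k` are independent of everything determined by earlier samples. -/
lemma IsIIDSample.indepFun_block [MeasurableSpace Ξ] {μ : Measure Ω} {P : Measure Ξ} {ξ : ℕ × ℕ → Ω → Ξ}
    (hξ : IsIIDSample μ P ξ) (k : ℕ) {α : Type*} [MeasurableSpace α] {X : Ω → α}
    (hX : Measurable[⨆ p ∈ {p : ℕ × ℕ | p.1 < k}, MeasurableSpace.comap (ξ p) inferInstance] X) :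
    IndepFun X (fun ω i => ξ (k, i) ω) μ := by
  rw [IndepFun_iff_Indep]
  have h := indep_iSup_of_disjoint (S := {p : ℕ × ℕ | p.1 < k}) (T := {p : ℕ × ℕ | p.1 = k})
    (fun p => (hξ.measurable p).comap_le) hξ.indep
    (Set.disjoint_left.2 fun p (hp : p.1 < k) (hp' : p.1 = k) => by omega)
  refine indep_of_indep_of_le_left (indep_of_indep_of_le_right h ?_) hX.comap_le
  refine Measurable.comap_le ?_
  refine @measurable_pi_lambda _ _ _ (_) _ _ fun i => ?_
  rw [measurable_iff_comap_le]
  exact le_iSup₂_of_le (k, i) rfl le_rfl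

/-- The potential has stayed below `R² / 2` up to time `k`. -/
def Stays (f : Euc n → ℝ) (xs : Euc n) (L a R : ℝ) (X : ℕ → Euc n × Euc n) (k : ℕ) : Prop :=
  ∀ i ≤ k, potential f xs L a i (X i) ≤ R ^ 2 / 2

open Classical in
/-- The exponential of the potential, frozen at the threshold once that has been exceeded. -/
noncomputable def stoppedExp (f : Euc n → ℝ) (xs : Euc n) (L a R s : ℝ) (X : ℕ → Euc n × Euc n)
    (k : ℕ) : ENNReal :=
  if Stays f xs L a R X k then ENNReal.ofReal (Real.exp (s * potential f xs L a k (X k)))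
  else ENNReal.ofReal (Real.exp (s * (R ^ 2 / 2)))

/-- The gap term of the potential is nonnegative, so every `z^i` is in the ball, and `y^k` is an
average of these points. -/
lemma Stays.fst_mem {f : Euc n → ℝ} {G : Euc n → Ξ → Euc n} {L a B R : ℝ} {x₀ xs : Euc n}
    {m : ℕ → ℕ} (hL : 0 < L) (ha : 0 < a) (hR : 0 ≤ R) (hxs : ∀ x, f xs ≤ f x)
    {t : ℕ → ℕ → Ξ} {k : ℕ} (h : Stays f xs L a R (iterates G x₀ L a B m t) k) :
    ‖(iterates G x₀ L a B m t k).1 - xs‖ ≤ R := by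
  refine norm_iterates_fst_sub_le hL ha m t k fun i hi => ?_
  refine abs_le_of_sq_le_sq' ?_ hR |>.2
  have := h i hi
  simp only [potential] at this
  nlinarith [mul_nonneg (stepA_nonneg ha hL i) (sub_nonneg.2 (hxs (iterates G x₀ L a B m t i).1))]

section Trajectory

variable [MeasurableSpace Ξ] {f : Euc n → ℝ} {P : Measure Ξ} {G : Euc n → Ξ → Euc n} {L σ a B R s v : ℝ}
  {x₀ xs : Euc n} {μ : Measure Ω} {ξ : ℕ × ℕ → Ω → Ξ} {m : ℕ → ℕ}

lemma measurable_stays (hf : Continuous f) (hG : Measurable (Function.uncurry G)) (k : ℕ)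
    (hξ : ∀ p : ℕ × ℕ, p.1 < k → Measurable (ξ p)) :
    Measurable fun ω => Stays f xs L a R (iterates G x₀ L a B m fun j i => ξ (j, i) ω) k := by
  refine measurableSet_setOfPred.1 ?_
  simp only [Stays, Set.ofPred_forall]
  refine MeasurableSet.iInter fun i => MeasurableSet.iInter fun hi => ?_
  exact measurableSet_le ((measurable_potential hf xs L a i).comp
    (measurable_iterates hG x₀ L a B m i fun p hp => hξ p (hp.trans_le hi))) measurable_const

/-- Before the crossing the conditional one-step bound applies; after it the process is constant,
and the growth factor is at least `1`. -/
lemma lintegral_stoppedExp_succ_le [IsProbabilityMeasure μ] (hL : 0 < L)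
    (hc : ConvexOn ℝ Set.univ f) (hf : LSmooth f L) (hG : IsStochasticGradient f P G σ)
    (hξ : IsIIDSample μ P ξ) (hxs : ∀ x, f xs ≤ f x) (ha : 2 ≤ a) (hB : 0 < B)
    (hBR : 16 * B ≤ R) (hs : 0 ≤ s) (hsRB : s * R * B ≤ 3 / 8)
    (haB : R * (2 / a + 3 / (2 * √a)) ≤ B / 2) (k : ℕ) (hm : 0 < m k) (hv0 : 0 ≤ v)
    (hv : stepα a L (k + 1) ^ 2 * σ ^ 2 / m k ≤ v) :
    ∫⁻ ω, stoppedExp f xs L a R s (iterates G x₀ L a B m fun j i => ξ (j, i) ω) (k + 1) ∂μ ≤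
      ENNReal.ofReal (Real.exp ((s * R / (2 * B) + s + 2 * s ^ 2 * R ^ 2) * v)) *
      ∫⁻ ω, stoppedExp f xs L a R s (iterates G x₀ L a B m fun j i => ξ (j, i) ω) k ∂μ := by
  classical
  have ha0 : 0 < a := by linarith
  have hR : 0 ≤ R := by linarith
  set X : Ω → ℕ → Euc n × Euc n := fun ω => iterates G x₀ L a B m fun j i => ξ (j, i) ω with hX
  -- The past enters only through the current state and the truth value of not having crossed; the
  -- last argument is the fresh sample block.
  set h : ((Euc n × Euc n) × Prop) × (ℕ → Ξ) → ENNReal := fun q =>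
    if q.1.2 then ENNReal.ofReal
      (Real.exp (s * potential f xs L a (k + 1) (stepState G L a B m k q.1.1 q.2)))
    else ENNReal.ofReal (Real.exp (s * (R ^ 2 / 2))) with hh
  have hfc : Continuous f := hf.1.continuous
  have hhm : Measurable h := by
    refine Measurable.ite (measurableSet_setOfPred.2 (measurable_snd.comp measurable_fst)) ?_
      measurable_const
    have h0 : Measurable fun q : ((Euc n × Euc n) × Prop) × (ℕ → Ξ) => (q.1.1, q.2) := by
      fun_prop
    have h1 := Measurable.comp (measurable_stepState hG.measurable L a B m k) h0
    have h2 := (measurable_potential hfc xs L a (k + 1)).comp h1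
    simp only [Function.comp_def] at h2
    exact (h2.const_mul s).exp.ennreal_ofReal
  have hXm : ∀ mΩ : MeasurableSpace Ω,
      (∀ p : ℕ × ℕ, p.1 < k → Measurable[mΩ] (ξ p)) →
      Measurable[mΩ] fun ω => (X ω k, Stays f xs L a R (X ω) k) := fun mΩ hp =>
    (measurable_iterates hG.measurable x₀ L a B m k hp).prodMk
      (measurable_stays hfc hG.measurable k hp)
  have hind : IndepFun (fun ω => (X ω k, Stays f xs L a R (X ω) k)) (fun ω i => ξ (k, i) ω) μ :=
    hξ.indepFun_block k (hXm _ fun p hp =>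
      measurable_iff_comap_le.2 (le_iSup₂_of_le p hp le_rfl))
  -- At a crossing the frozen value is below the true exponential, so the unfrozen next value may be
  -- used whenever time `k` was good.
  have hle : ∀ ω, stoppedExp f xs L a R s (X ω) (k + 1) ≤
      h ((X ω k, Stays f xs L a R (X ω) k), fun i => ξ (k, i) ω) := by
    intro ω
    have hiff : Stays f xs L a R (X ω) (k + 1) ↔ Stays f xs L a R (X ω) k ∧
        potential f xs L a (k + 1) (X ω (k + 1)) ≤ R ^ 2 / 2 :=
      ⟨fun H => ⟨fun i hi => H i (hi.trans k.le_succ), H _ le_rfl⟩, fun H i hi =>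
        (Nat.le_succ_iff.1 hi).elim (H.1 i) fun e => e ▸ H.2⟩
    simp only [stoppedExp, hh]
    by_cases h1 : Stays f xs L a R (X ω) k
    · by_cases h2 : Stays f xs L a R (X ω) (k + 1)
      · rw [if_pos h2, if_pos h1]; exact le_rfl
      · rw [if_neg h2, if_pos h1]
        have h3 : R ^ 2 / 2 < potential f xs L a (k + 1) (X ω (k + 1)) := by
          by_contra h4
          exact h2 (hiff.2 ⟨h1, not_lt.1 h4⟩)
        exact ENNReal.ofReal_le_ofReal (Real.exp_le_exp.2 (mul_le_mul_of_nonneg_left h3.le hs))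
    · rw [if_neg h1, if_neg fun h2 => h1 (hiff.1 h2).1]
  refine (lintegral_mono hle).trans ?_
  rw [lintegral_comp_of_indepFun (hXm _ fun p _ => hξ.measurable p)
    (measurable_pi_lambda _ fun i => hξ.measurable (k, i)) hind hhm,
    ← lintegral_const_mul' _ _ ENNReal.ofReal_ne_top]
  refine lintegral_mono fun ω => ?_
  change _ ≤ _ * stoppedExp f xs L a R s (X ω) k
  simp only [hh, stoppedExp]
  by_cases h1 : Stays f xs L a R (X ω) k
  · simp only [if_pos h1]
    exact lintegral_exp_potential_stepState_le hL hc hf hG (fun i => hξ.measurable (k, i))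
      (fun i => hξ.map_eq (k, i)) (hξ.indep.precomp (Prod.mk_right_injective k)) hxs ha hB hBR hs
      hsRB haB m k hm hv (X ω k) (h1.fst_mem hL ha0 hR hxs) (h1 k le_rfl)
  · simp only [if_neg h1]
    rw [lintegral_const, measure_univ, mul_one]
    refine le_mul_of_one_le_left (zero_le) ?_
    rw [ENNReal.one_le_ofReal]
    exact Real.one_le_exp (by positivity)

/-- The potential stays below the threshold with high probability. -/
lemma measure_not_stays_le [IsProbabilityMeasure μ] (hL : 0 < L)
    (hc : ConvexOn ℝ Set.univ f) (hf : LSmooth f L) (hG : IsStochasticGradient f P G σ)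
    (hξ : IsIIDSample μ P ξ) (hxs : ∀ x, f xs ≤ f x) (ha : 2 ≤ a) (hB : 0 < B)
    (hBR : 16 * B ≤ R) (hs : 0 ≤ s) (hsRB : s * R * B ≤ 3 / 8)
    (haB : R * (2 / a + 3 / (2 * √a)) ≤ B / 2) (hm : ∀ k, 0 < m k) (hv0 : 0 ≤ v) (N : ℕ)
    (hv : ∀ k < N, stepα a L (k + 1) ^ 2 * σ ^ 2 / m k ≤ v) (hR₀ : ‖x₀ - xs‖ ≤ R) :
    μ {ω | ¬ Stays f xs L a R (iterates G x₀ L a B m fun j i => ξ (j, i) ω) N} ≤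
      ENNReal.ofReal (Real.exp (N * ((s * R / (2 * B) + s + 2 * s ^ 2 * R ^ 2) * v) +
        s * (‖x₀ - xs‖ ^ 2 / 2) - s * (R ^ 2 / 2))) := by
  classical
  set δ := (s * R / (2 * B) + s + 2 * s ^ 2 * R ^ 2) * v with hδ
  set X : Ω → ℕ → Euc n × Euc n := fun ω => iterates G x₀ L a B m fun j i => ξ (j, i) ω with hX
  have hind : ∀ k ≤ N, ∫⁻ ω, stoppedExp f xs L a R s (X ω) k ∂μ ≤
      ENNReal.ofReal (Real.exp (k * δ + s * (‖x₀ - xs‖ ^ 2 / 2))) := by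
    intro k
    induction k with
    | zero =>
      intro _
      have hp : ∀ ω, potential f xs L a 0 (X ω 0) = ‖x₀ - xs‖ ^ 2 / 2 := fun ω => by
        simp [potential, stepA, hX, iterates]
      have hS : ∀ ω, Stays f xs L a R (X ω) 0 := fun ω i hi => by
        obtain rfl := Nat.le_zero.1 hi
        rw [hp]
        have := pow_le_pow_left₀ (norm_nonneg _) hR₀ 2
        linarith
      simp [stoppedExp, hS, hp]
    | succ k ih =>
      intro hk
      refine (lintegral_stoppedExp_succ_le hL hc hf hG hξ hxs ha hB hBR hs hsRB haB k (hm k) hv0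
        (hv k hk)).trans ?_
      refine (mul_le_mul_right (ih (by omega)) _).trans ?_
      rw [← ENNReal.ofReal_mul (Real.exp_pos _).le, ← Real.exp_add]
      refine ENNReal.ofReal_le_ofReal (Real.exp_le_exp.2 ?_)
      push_cast
      linarith
  have hmS : MeasurableSet {ω | ¬ Stays f xs L a R (X ω) N} :=
    (measurableSet_setOfPred.2 (measurable_stays hf.1.continuous hG.measurable N
      fun p _ => hξ.measurable p)).compl
  -- Markov's inequality; freezing guarantees that a crossing at any earlier time is still visible
  -- at time `N`.
  have h1 : ENNReal.ofReal (Real.exp (s * (R ^ 2 / 2))) * μ {ω | ¬ Stays f xs L a R (X ω) N} ≤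
      ∫⁻ ω, stoppedExp f xs L a R s (X ω) N ∂μ := by
    rw [← lintegral_indicator_const hmS]
    refine lintegral_mono fun ω => ?_
    by_cases h : Stays f xs L a R (X ω) N
    · simp [h]
    · simp [h, stoppedExp]
  have h2 := h1.trans (hind N le_rfl)
  rw [mul_comm, ← ENNReal.le_div_iff_mul_le (Or.inl (ENNReal.ofReal_pos.2 (Real.exp_pos _)).ne')
    (Or.inl ENNReal.ofReal_ne_top)] at h2
  rwa [Real.exp_sub, ENNReal.ofReal_div_of_pos (Real.exp_pos _)]

end Trajectory

end ClippedSSTM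

/-! ### Choice of parameters and the high-probability rate -/

namespace ClippedSSTM

variable {n : ℕ} {Ξ Ω : Type*} [MeasurableSpace Ξ] [MeasurableSpace Ω]

/-- With `l = logN N β`, the last term of `aMin` is the square of the larger root `12 l + √(144 l² +
72 l)` of `t² - 24 l t - 72 l`. -/
lemma Admissible.sqrt_bound {N : ℕ} {β a : ℝ} (h : Admissible N β a) :
    24 * logN N β * √a + 72 * logN N β ≤ a := by
  obtain ⟨_, hl, ha⟩ := h
  set l := logN N β
  have h1 : 36 * (2 * l + √(4 * l ^ 2 + 2 * l)) ^ 2 ≤ a :=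
    ((le_max_right _ _).trans (le_max_right _ _)).trans ha
  have hr : 0 ≤ √(4 * l ^ 2 + 2 * l) := Real.sqrt_nonneg _
  have hr2 : √(4 * l ^ 2 + 2 * l) ^ 2 = 4 * l ^ 2 + 2 * l := Real.sq_sqrt (by nlinarith)
  have ha0 : 0 ≤ a := le_trans (by positivity) h1
  have h2 : 6 * (2 * l + √(4 * l ^ 2 + 2 * l)) ≤ √a := by
    refine Real.le_sqrt_of_sq_le ?_
    nlinarith
  have h3 : √a ^ 2 = a := Real.sq_sqrt ha0
  have h4 : (6 * √(4 * l ^ 2 + 2 * l)) ^ 2 ≤ (√a - 12 * l) ^ 2 :=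
    pow_le_pow_left₀ (by positivity) (by linarith) 2
  nlinarith

/-- High-probability convergence rate of `clipped-SSTM`. -/
theorem output_gap_le {P : Measure Ξ} {μ : Measure Ω} [IsProbabilityMeasure μ]
    {f : Euc n → ℝ} {G : Euc n → Ξ → Euc n} {ξ : ℕ × ℕ → Ω → Ξ} {x₀ xs : Euc n}
    {L σ R₀ β a : ℝ} {N : ℕ} (hL : 0 < L) (hβ : 0 < β) (hc : ConvexOn ℝ Set.univ f)
    (hf : LSmooth f L) (hG : IsStochasticGradient f P G σ) (hξ : IsIIDSample μ P ξ)
    (hxs : ∀ x, f xs ≤ f x) (hR₀ : R₀ = ‖x₀ - xs‖) (hR₀pos : 0 < R₀) (hadm : Admissible N β a) :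
    1 - β ≤ μ.real {ω | f (output G ξ x₀ L σ R₀ a N β ω) - f xs ≤
      10 * a * L * R₀ ^ 2 / (N * (N + 3))} := by
  have hsq := hadm.sqrt_bound
  obtain ⟨hN, hl, -⟩ := hadm
  have hNpos : (0 : ℝ) < N := by exact_mod_cast hN
  have hN1 : (1 : ℝ) ≤ N := by exact_mod_cast hN
  have hlβ : Real.exp (-logN N β) = β / (4 * N) := by
    rw [logN, Real.exp_neg, Real.exp_log (by positivity), inv_div]
  set l := logN N β with hldef
  have ha : 2 ≤ a := by nlinarith [Real.sqrt_nonneg a]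
  have ha0 : 0 < a := by linarith
  have hsa : 0 < √a := Real.sqrt_pos.2 ha0
  have hl0 : 0 < l := by linarith
  set R := √5 * R₀ with hRdef
  have h5 : √5 ^ 2 = (5 : ℝ) := Real.sq_sqrt (by norm_num)
  have hR2 : R ^ 2 = 5 * R₀ ^ 2 := by rw [hRdef, mul_pow, h5]
  have hR : 0 < R := by positivity
  set B := clipB N β R₀ with hBdef
  have hB : B = R / (8 * l) := rfl
  have hBpos : 0 < B := by rw [hB]; positivity
  have hBR : 16 * B ≤ R := by
    rw [hB, ← mul_div_assoc, div_le_iff₀ (by positivity)]; nlinarith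
  -- This is the largest `s` with `s R B ≤ 3 / 8`. Since `R² = 5 R₀²`, the distance from the initial
  -- potential to the threshold contributes `-6 l / 5` to the exponent, which leaves room for the
  -- accumulated drift.
  set s := 3 * l / R ^ 2 with hs
  have hs0 : 0 ≤ s := by positivity
  have hsRB : s * R * B ≤ 3 / 8 := by
    rw [hs, hB]; apply le_of_eq; field_simp
  have haB : R * (2 / a + 3 / (2 * √a)) ≤ B / 2 := by
    have e : B / 2 = R * (1 / (16 * l)) := by rw [hB]; field_simp; norm_num
    rw [e]
    gcongr
    have e2 : 2 / a + 3 / (2 * √a) = (2 + 3 / 2 * √a) / a := by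
      have := Real.sq_sqrt ha0.le
      field_simp
      nlinarith
    -- What remains is `32 l + 24 l √a ≤ a`.
    rw [e2, div_le_div_iff₀ ha0 (by positivity)]
    nlinarith
  -- The variance level that the first batchsize term enforces; over `N` steps the drift is then
  -- only `(30 l + 3) / 6000`.
  set v := R ^ 2 / (6000 * N * l) with hv
  have hv0 : 0 < v := by positivity
  have hbatch : ∀ k, batchReal L σ R₀ a N β k ≤ (batchSize L σ R₀ a N β k : ℝ) :=
    fun k => Nat.le_ceil _
  have hm : ∀ k, 0 < batchSize L σ R₀ a N β k := fun k =>
    Nat.ceil_pos.2 (zero_lt_one.trans_le (le_max_left _ _))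
  have hvk : ∀ k < N, stepα a L (k + 1) ^ 2 * σ ^ 2 / batchSize L σ R₀ a N β k ≤ v := by
    intro k _
    rw [div_le_iff₀ (Nat.cast_pos.2 (hm k))]
    have h1 : 6000 * σ ^ 2 * stepα a L (k + 1) ^ 2 * N * l / R ^ 2 ≤
        batchSize L σ R₀ a N β k := by
      rw [hRdef, mul_pow]
      exact ((le_max_left _ _).trans (le_max_right _ _)).trans (hbatch k)
    refine le_trans (le_of_eq ?_) (mul_le_mul_of_nonneg_left h1 hv0.le)
    rw [hv]; field_simp
  have hR₀R : ‖x₀ - xs‖ ≤ R := by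
    rw [← hR₀]
    refine abs_le_of_sq_le_sq' ?_ hR.le |>.2
    nlinarith [sq_nonneg R₀]
  have hmain := measure_not_stays_le hL hc hf hG hξ hxs ha hBpos hBR hs0 hsRB haB hm hv0.le N hvk
    hR₀R
  have hexp : N * ((s * R / (2 * B) + s + 2 * s ^ 2 * R ^ 2) * v) + s * (‖x₀ - xs‖ ^ 2 / 2) -
      s * (R ^ 2 / 2) ≤ -l := by
    have e1 : N * ((s * R / (2 * B) + s + 2 * s ^ 2 * R ^ 2) * v) = (30 * l + 3) / 6000 := by
      rw [hs, hB, hv]; field_simp; ring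
    have e2 : s * (‖x₀ - xs‖ ^ 2 / 2) = 3 * l / 10 := by
      rw [← hR₀, hs, hR2]; field_simp; ring
    have e3 : s * (R ^ 2 / 2) = 3 * l / 2 := by rw [hs]; field_simp
    rw [e1, e2, e3]; linarith
  have hbad : μ.real {ω | ¬ Stays f xs L a R (iterates G x₀ L a B (batchSize L σ R₀ a N β)
      fun j i => ξ (j, i) ω) N} ≤ β := by
    refine ENNReal.toReal_le_of_le_ofReal hβ.le (hmain.trans (ENNReal.ofReal_le_ofReal ?_))
    refine (Real.exp_le_exp.2 hexp).trans ?_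
    rw [hlβ, div_le_iff₀ (by positivity)]
    nlinarith
  have hmS : MeasurableSet {ω | Stays f xs L a R (iterates G x₀ L a B (batchSize L σ R₀ a N β)
      fun j i => ξ (j, i) ω) N} :=
    measurableSet_setOfPred.2 (measurable_stays hf.1.continuous hG.measurable N
      fun p _ => hξ.measurable p)
  have hcompl := probReal_compl_eq_one_sub (μ := μ) hmS
  rw [show {ω | Stays f xs L a R (iterates G x₀ L a B (batchSize L σ R₀ a N β)
      fun j i => ξ (j, i) ω) N}ᶜ = {ω | ¬ Stays f xs L a R (iterates G x₀ L a B
      (batchSize L σ R₀ a N β) fun j i => ξ (j, i) ω) N} from rfl] at hcompl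
  refine le_trans (by linarith) (measureReal_mono fun ω hω => ?_)
  have h := (show Stays f xs L a R _ N from hω) N le_rfl
  have hA : stepA a L N = N * (N + 3) / (4 * a * L) := stepA_eq a L N
  have hApos : 0 < stepA a L N := by rw [hA]; positivity
  simp only [potential] at h
  have h2 : stepA a L N * (f (output G ξ x₀ L σ R₀ a N β ω) - f xs) ≤ 5 * R₀ ^ 2 / 2 := by
    rw [← hR2]
    refine le_trans (le_add_of_nonneg_right ?_) h
    positivity
  show f (output G ξ x₀ L σ R₀ a N β ω) - f xs ≤ _
  rw [mul_comm, ← le_div_iff₀ hApos] at h2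
  refine h2.trans (le_of_eq ?_)
  rw [hA]; field_simp; ring

end ClippedSSTM

/-! ### Logarithmic inversion and existence of admissible `N` -/

namespace ClippedSSTM

lemma log_le_log_add_div_sub_one {y s : ℝ} (hy : 0 < y) (hs : 0 < s) :
    Real.log y ≤ Real.log s + y / s - 1 := by
  have h := Real.log_le_sub_one_of_pos (div_pos hy hs)
  rw [Real.log_div hy.ne' hs.ne'] at h
  linarith

lemma log_two_le_log_div {u β : ℝ} (hu : 2 ≤ u) (hβ : 0 < β) (hβ1 : β < 1) :
    Real.log 2 ≤ Real.log (u / β) := by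
  refine Real.log_le_log (by norm_num) (hu.trans ?_)
  rw [le_div_iff₀ hβ]
  nlinarith

/-- Inverting `N ≥ K u ^ p log (u / β)` into `N ≳ u ^ p log (4 N / β)`. -/
lemma mul_log_le_of_le {u β N : ℝ} {p : ℕ} (hp2 : p ≤ 2) (hu : 2 ≤ u) (hβ : 0 < β)
    (hβ1 : β < 1) (hN : 65536 * (u ^ p * Real.log (u / β)) ≤ N) :
    700 * u ^ p * Real.log (4 * N / β) ≤ N := by
  have hlam := log_two_le_log_div hu hβ hβ1
  have hlog2 := Real.log_two_gt_d9
  set lam := Real.log (u / β) with hlamdef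
  have hlam0 : 0 < lam := by linarith
  have hu0 : 0 < u := by linarith
  set w := u ^ p with hw
  have hw0 : 0 < w := by positivity
  have hs0 : 0 < 65536 * (w * lam) := by positivity
  have hN0 : 0 < N := hs0.trans_le hN
  -- The tangent line of the logarithm at the smallest allowed `N` makes the bound linear in `N`;
  -- the value at the tangency point is at most `21 lam`, and both contributions fit within `N`
  -- because `65536` is large compared with `700 * 21`.
  have h1 := log_le_log_add_div_sub_one (y := 4 * N / β) (s := 4 * (65536 * (w * lam)) / β)
    (by positivity) (by positivity)
  have h2 : 4 * N / β / (4 * (65536 * (w * lam)) / β) = N / (65536 * (w * lam)) := by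
    field_simp
  have h3 : Real.log (4 * (65536 * (w * lam)) / β) ≤ 21 * lam := by
    have e : 4 * (65536 * (w * lam)) / β = 2 ^ 18 * (w * (lam * β⁻¹)) := by
      field_simp; norm_num
    have hlb : Real.log (β⁻¹) = -Real.log β := Real.log_inv β
    have hlβ : Real.log β < 0 := Real.log_neg hβ hβ1
    have hlu : 0 ≤ Real.log u := Real.log_nonneg (by linarith)
    rw [e, Real.log_mul (by norm_num) (by positivity), Real.log_mul hw0.ne' (by positivity),
      Real.log_mul hlam0.ne' (by positivity), Real.log_pow, hw, Real.log_pow, hlb]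
    have hl : lam = Real.log u - Real.log β := Real.log_div hu0.ne' hβ.ne'
    have hll := Real.log_le_sub_one_of_pos hlam0
    have hp : (p : ℝ) ≤ 2 := by exact_mod_cast hp2
    have := mul_le_mul_of_nonneg_right hp hlu
    push_cast
    linarith
  rw [h2] at h1
  have h4 : 700 * w * (N / (65536 * (w * lam))) ≤ N / 2 := by
    have e : 700 * w * (N / (65536 * (w * lam))) = N * (700 / (65536 * lam)) := by field_simp
    have e' : 700 / (65536 * lam) ≤ 1 / 2 := by
      rw [div_le_div_iff₀ (by positivity) (by norm_num)]
      linarith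
    rw [e, div_eq_mul_one_div N 2]
    exact mul_le_mul_of_nonneg_left e' hN0.le
  have h5 : 700 * w * Real.log (4 * N / β) ≤
      700 * w * (21 * lam) + 700 * w * (N / (65536 * (w * lam))) := by
    rw [← mul_add]
    exact mul_le_mul_of_nonneg_left (by linarith) (by positivity)
  have h6 : 0 < w * lam := by positivity
  nlinarith

lemma aMin_le {N : ℕ} {β : ℝ} (hl : 2 ≤ logN N β) : aMin N β ≤ 648 * logN N β ^ 2 := by
  set l := logN N β with hldef
  unfold aMin
  rw [← hldef]
  have h5 : (1 : ℝ) ≤ √5 := Real.one_le_sqrt.2 (by norm_num)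
  refine max_le (by nlinarith) (max_le ?_ ?_)
  · rw [div_le_iff₀ (by linarith)]
    nlinarith [mul_le_mul_of_nonneg_left h5 (sq_nonneg l)]
  · have hr : √(4 * l ^ 2 + 2 * l) ≤ 2.24 * l := by
      refine Real.sqrt_le_iff.2 ⟨by linarith, by nlinarith⟩
    have h2 : (2 * l + √(4 * l ^ 2 + 2 * l)) ^ 2 ≤ (4.24 * l) ^ 2 :=
      pow_le_pow_left₀ (by positivity) (by linarith) 2
    nlinarith [sq_nonneg l]

/-- Dividing `sqrt_bound` by `√a` gives `√a ≥ 24 logN N β`. -/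
lemma Admissible.sq_le {N : ℕ} {β a : ℝ} (h : Admissible N β a) : 576 * logN N β ^ 2 ≤ a := by
  have h1 := h.sqrt_bound
  have hl := h.2.1
  have ha : 0 ≤ a := le_trans (by positivity) h1
  have h2 := Real.sq_sqrt ha
  have hs : 0 < √a := by
    refine Real.sqrt_pos.2 (lt_of_lt_of_le ?_ h1)
    positivity
  have h3 : 24 * logN N β ≤ √a := by
    refine le_of_mul_le_mul_right ?_ hs
    nlinarith
  nlinarith

lemma exists_nat_between {t : ℝ} (ht : 1 ≤ t) : ∃ N : ℕ, t ≤ N ∧ N ≤ 2 * t :=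
  ⟨⌈t⌉₊, Nat.le_ceil t, by linarith [(Nat.ceil_lt_add_one (by linarith : 0 ≤ t)).le]⟩

lemma two_le_logN {N : ℕ} {β : ℝ} (hβ : 0 < β) (hβ1 : β < 1) (hN : 2 ≤ N) : 2 ≤ logN N β := by
  have hN' : (2 : ℝ) ≤ N := by exact_mod_cast hN
  rw [logN, Real.le_log_iff_exp_le (by positivity)]
  have h1 : Real.exp 2 = Real.exp 1 ^ 2 := by rw [← Real.exp_nat_mul]; norm_num
  have h2 := Real.exp_one_lt_d9
  have h3 := Real.exp_pos 1
  rw [le_div_iff₀ hβ, h1]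
  have h4 : Real.exp 1 ^ 2 ≤ 8 := by nlinarith
  nlinarith [sq_nonneg (Real.exp 1)]

lemma rpow_three_halves (x : ℝ) (hx : 0 ≤ x) : x ^ (3 / 2 : ℝ) = x * √x := by
  rcases hx.eq_or_lt with rfl | hx
  · norm_num
  · rw [Real.sqrt_eq_rpow, ← Real.rpow_one_add' hx.le (by norm_num)]; norm_num

lemma two_le_mul_log {u β : ℝ} {p : ℕ} (hu : 2 ≤ u) (hβ : 0 < β) (hβ1 : β < 1) :
    2 ≤ 65536 * (u ^ p * Real.log (u / β)) := by
  have h1 := log_two_le_log_div hu hβ hβ1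
  have h2 := Real.log_two_gt_d9
  have h3 : 1 ≤ u ^ p := one_le_pow₀ (by linarith)
  nlinarith [mul_le_mul h3 h1 (by linarith) (by linarith)]

lemma exists_admissible_medium {u β : ℝ} (hu : 2 ≤ u) (hβ : 0 < β) (hβ1 : β < 1) :
    ∃ N : ℕ, Admissible N β (aMedium N β) ∧ 65536 * (u * Real.log (u / β)) ≤ N ∧
      N ≤ 2 * 65536 * (u * Real.log (u / β)) := by
  have h1 := two_le_mul_log (p := 1) hu hβ hβ1
  rw [pow_one] at h1
  obtain ⟨N, hN, hN2⟩ := exists_nat_between (by linarith : 1 ≤ 65536 * (u * Real.log (u / β)))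
  have hN' : 2 ≤ N := by exact_mod_cast h1.trans hN
  have hl := two_le_logN hβ hβ1 hN'
  have h2 := mul_log_le_of_le (p := 1) (N := N) one_le_two hu hβ hβ1 (by rwa [pow_one])
  refine ⟨N, ⟨by omega, hl, (aMin_le hl).trans ?_⟩, hN, by linarith⟩
  change 700 * u ^ 1 * logN N β ≤ N at h2
  rw [aMedium]
  nlinarith

/-- From `N ≥ 700 v² l` one gets `a₀ N^{3/2} √l ≥ 18200 a₀ v³ l²`, so `a₀ v³ ≥ 1` is what lifts `a`
above `648 l²`. For `v = a₀ L R₀² / ε` this is the condition `ε³ ≤ a₀⁴ (L R₀²)³`. -/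
lemma exists_admissible_const {a₀ v β : ℝ} (hv : 2 ≤ v) (ha₀ : 1 ≤ a₀ * v ^ 3) (hβ : 0 < β)
    (hβ1 : β < 1) :
    ∃ N : ℕ, Admissible N β (aConst a₀ N β) ∧ 65536 * (v ^ 2 * Real.log (v / β)) ≤ N ∧
      N ≤ 2 * 65536 * (v ^ 2 * Real.log (v / β)) := by
  have h1 := two_le_mul_log (p := 2) hv hβ hβ1
  obtain ⟨N, hN, hN2⟩ := exists_nat_between
    (by linarith : 1 ≤ 65536 * (v ^ 2 * Real.log (v / β)))
  have hN' : 2 ≤ N := by exact_mod_cast h1.trans hN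
  have hl := two_le_logN hβ hβ1 hN'
  have h2 := mul_log_le_of_le (p := 2) le_rfl hv hβ hβ1 hN
  refine ⟨N, ⟨by omega, hl, (aMin_le hl).trans ?_⟩, hN, by linarith⟩
  change 700 * v ^ 2 * logN N β ≤ N at h2
  rw [aConst, rpow_three_halves _ (Nat.cast_nonneg N)]
  set l := logN N β
  have hs : √l ^ 2 = l := Real.sq_sqrt (by linarith)
  have hs0 : 0 ≤ √l := Real.sqrt_nonneg l
  have h3 : 26 * v * √l ≤ √N := by
    refine Real.le_sqrt_of_sq_le ?_
    rw [mul_pow, hs]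
    nlinarith [mul_nonneg (sq_nonneg v) (by linarith : 0 ≤ l)]
  have hv0 : 0 < v := by linarith
  have ha₀0 : 0 < a₀ := by
    by_contra h
    nlinarith [mul_nonneg (neg_nonneg.2 (not_lt.1 h)) (pow_pos hv0 3).le]
  calc 648 * l ^ 2 ≤ 18200 * l ^ 2 * (a₀ * v ^ 3) := by nlinarith [sq_nonneg l]
    _ = a₀ * ((700 * v ^ 2 * l) * (26 * v * √l)) * √l := by
        linear_combination (-(18200 * l * (a₀ * v ^ 3))) * hs
    _ ≤ a₀ * (N * √N) * √l := by gcongr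

/-! ### Batchsizes and their sums -/

lemma batchReal_medium {L σ R₀ β : ℝ} {N : ℕ} (hN : 1 ≤ N) (hl : 2 ≤ logN N β)
    (k : ℕ) : batchReal L σ R₀ (aMedium N β) N β k = max 1 (max
      (6000 * σ ^ 2 * ((k : ℝ) + 2) ^ 2 /
        (4 * L ^ 2 * N * √5 ^ 2 * R₀ ^ 2 * Real.log (4 * N / β)))
      (10368 * σ ^ 2 * ((k : ℝ) + 2) ^ 2 /
        (4 * L ^ 2 * √5 ^ 2 * R₀ ^ 2 * N * Real.log (4 * N / β) ^ 2))) := by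
  have hN0 : (N : ℝ) ≠ 0 := by positivity
  change _ = max 1 (max (6000 * σ ^ 2 * ((k : ℝ) + 2) ^ 2 /
        (4 * L ^ 2 * N * √5 ^ 2 * R₀ ^ 2 * logN N β))
      (10368 * σ ^ 2 * ((k : ℝ) + 2) ^ 2 /
        (4 * L ^ 2 * √5 ^ 2 * R₀ ^ 2 * N * logN N β ^ 2)))
  rw [batchReal, stepα, aMedium]
  set l := logN N β
  have hl0 : l ≠ 0 := by positivity
  congr 2
  · field_simp; ring
  · field_simp; ring

lemma batchReal_const {L σ R₀ β a₀ : ℝ} {N : ℕ} (hN : 1 ≤ N) (hl : 2 ≤ logN N β)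
    (k : ℕ) : batchReal L σ R₀ (aConst a₀ N β) N β k = max 1 (max
      (6000 * σ ^ 2 * ((k : ℝ) + 2) ^ 2 /
        (4 * a₀ ^ 2 * L ^ 2 * N ^ 2 * √5 ^ 2 * R₀ ^ 2))
      (10368 * σ ^ 2 * ((k : ℝ) + 2) ^ 2 /
        (4 * a₀ ^ 2 * L ^ 2 * √5 ^ 2 * R₀ ^ 2 * N ^ 2 * Real.log (4 * N / β)))) := by
  have hN0 : (N : ℝ) ≠ 0 := by positivity
  change _ = max 1 (max (6000 * σ ^ 2 * ((k : ℝ) + 2) ^ 2 /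
        (4 * a₀ ^ 2 * L ^ 2 * N ^ 2 * √5 ^ 2 * R₀ ^ 2))
      (10368 * σ ^ 2 * ((k : ℝ) + 2) ^ 2 /
        (4 * a₀ ^ 2 * L ^ 2 * √5 ^ 2 * R₀ ^ 2 * N ^ 2 * logN N β)))
  set l := logN N β with hldef
  have hl0 : l ≠ 0 := by positivity
  have hα : stepα (aConst a₀ N β) L (k + 1) ^ 2 =
      ((k : ℝ) + 2) ^ 2 / (4 * a₀ ^ 2 * L ^ 2 * N ^ 3 * l) := by
    rw [stepα, aConst, rpow_three_halves _ (Nat.cast_nonneg N), div_pow]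
    congr 1
    simp only [mul_pow]
    rw [Real.sq_sqrt (Nat.cast_nonneg N), ← hldef, Real.sq_sqrt (by linarith)]
    ring
  rw [batchReal, hα, ← hldef]
  congr 2
  · field_simp
  · field_simp

lemma batchSize_le_of_eq {L σ R₀ a β x y z : ℝ} {N k : ℕ}
    (h : batchReal L σ R₀ a N β k = max 1 (max x y)) (hx : 0 ≤ x) (hy : 0 ≤ y)
    (hz : x + y ≤ z) : (batchSize L σ R₀ a N β k : ℝ) ≤ 2 + z := by
  have h1 : batchReal L σ R₀ a N β k ≤ 1 + (x + y) := by
    rw [h]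
    exact max_le (by linarith) (max_le (by linarith) (by linarith))
  have h2 : 0 ≤ batchReal L σ R₀ a N β k := by
    rw [h]; exact zero_le_one.trans (le_max_left _ _)
  have h3 := (Nat.ceil_lt_add_one h2).le
  change (⌈batchReal L σ R₀ a N β k⌉₊ : ℝ) ≤ _
  linarith

lemma batchSize_medium_le {L σ R₀ β : ℝ} {N k : ℕ} (hL : 0 < L) (hR₀ : 0 < R₀)
    (hl : 2 ≤ logN N β) (hk : k < N) :
    (batchSize L σ R₀ (aMedium N β) N β k : ℝ) ≤
      2 + 2300 * (σ ^ 2 / (L ^ 2 * R₀ ^ 2)) * (N / logN N β) := by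
  have hN : 1 ≤ N := by omega
  have hN1 : (1 : ℝ) ≤ N := by exact_mod_cast hN
  have hkN : ((k : ℝ) + 2) ^ 2 ≤ 4 * N ^ 2 := by
    have : (k : ℝ) + 1 ≤ N := by exact_mod_cast hk
    nlinarith [(Nat.cast_nonneg k : (0 : ℝ) ≤ k)]
  have h5 : √5 ^ 2 = (5 : ℝ) := Real.sq_sqrt (by norm_num)
  have e := batchReal_medium (L := L) (σ := σ) (R₀ := R₀) hN hl k
  change _ = max 1 (max (6000 * σ ^ 2 * ((k : ℝ) + 2) ^ 2 /
        (4 * L ^ 2 * N * √5 ^ 2 * R₀ ^ 2 * logN N β))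
      (10368 * σ ^ 2 * ((k : ℝ) + 2) ^ 2 /
        (4 * L ^ 2 * √5 ^ 2 * R₀ ^ 2 * N * logN N β ^ 2))) at e
  set l := logN N β
  have hl0 : 0 < l := by linarith
  refine batchSize_le_of_eq e (by positivity) (by positivity) ?_
  rw [h5]
  have t1 : 6000 * σ ^ 2 * ((k : ℝ) + 2) ^ 2 / (4 * L ^ 2 * N * 5 * R₀ ^ 2 * l) ≤
      6000 * σ ^ 2 * (4 * N ^ 2) / (4 * L ^ 2 * N * 5 * R₀ ^ 2 * l) := by gcongr
  have t2 : 10368 * σ ^ 2 * ((k : ℝ) + 2) ^ 2 / (4 * L ^ 2 * 5 * R₀ ^ 2 * N * l ^ 2) ≤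
      10368 * σ ^ 2 * (4 * N ^ 2) / (4 * L ^ 2 * 5 * R₀ ^ 2 * N * (2 * l)) := by
    gcongr; nlinarith
  have e1 : 6000 * σ ^ 2 * (4 * N ^ 2) / (4 * L ^ 2 * N * 5 * R₀ ^ 2 * l) =
      1200 * (σ ^ 2 / (L ^ 2 * R₀ ^ 2) * (N / l)) := by field_simp; ring
  have e2 : 10368 * σ ^ 2 * (4 * N ^ 2) / (4 * L ^ 2 * 5 * R₀ ^ 2 * N * (2 * l)) =
      10368 / 10 * (σ ^ 2 / (L ^ 2 * R₀ ^ 2) * (N / l)) := by field_simp; ring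
  have h0 : 0 ≤ σ ^ 2 / (L ^ 2 * R₀ ^ 2) * (N / l) := by positivity
  rw [e1] at t1
  rw [e2] at t2
  rw [mul_assoc 2300]
  linarith

lemma batchSize_const_le {L σ R₀ β a₀ : ℝ} {N k : ℕ} (hL : 0 < L) (hR₀ : 0 < R₀) (ha₀ : 0 < a₀)
    (hN : 1 ≤ N) (hl : 2 ≤ logN N β) (hk : k ≤ N) :
    (batchSize L σ R₀ (aConst a₀ N β) N β k : ℝ) ≤
      2 + 5100 * (σ ^ 2 / (a₀ ^ 2 * L ^ 2 * R₀ ^ 2)) := by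
  have hN1 : (1 : ℝ) ≤ N := by exact_mod_cast hN
  have hkN : ((k : ℝ) + 2) ^ 2 ≤ 9 * N ^ 2 := by
    have : (k : ℝ) ≤ N := by exact_mod_cast hk
    nlinarith [(Nat.cast_nonneg k : (0 : ℝ) ≤ k)]
  have h5 : √5 ^ 2 = (5 : ℝ) := Real.sq_sqrt (by norm_num)
  have e := batchReal_const (L := L) (σ := σ) (R₀ := R₀) (a₀ := a₀) hN hl k
  change _ = max 1 (max (6000 * σ ^ 2 * ((k : ℝ) + 2) ^ 2 /
        (4 * a₀ ^ 2 * L ^ 2 * N ^ 2 * √5 ^ 2 * R₀ ^ 2))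
      (10368 * σ ^ 2 * ((k : ℝ) + 2) ^ 2 /
        (4 * a₀ ^ 2 * L ^ 2 * √5 ^ 2 * R₀ ^ 2 * N ^ 2 * logN N β))) at e
  set l := logN N β
  have hl0 : 0 < l := by linarith
  refine batchSize_le_of_eq e (by positivity) (by positivity) ?_
  rw [h5]
  have t1 : 6000 * σ ^ 2 * ((k : ℝ) + 2) ^ 2 / (4 * a₀ ^ 2 * L ^ 2 * N ^ 2 * 5 * R₀ ^ 2) ≤
      6000 * σ ^ 2 * (9 * N ^ 2) / (4 * a₀ ^ 2 * L ^ 2 * N ^ 2 * 5 * R₀ ^ 2) := by gcongr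
  have t2 : 10368 * σ ^ 2 * ((k : ℝ) + 2) ^ 2 /
        (4 * a₀ ^ 2 * L ^ 2 * 5 * R₀ ^ 2 * N ^ 2 * l) ≤
      10368 * σ ^ 2 * (9 * N ^ 2) / (4 * a₀ ^ 2 * L ^ 2 * 5 * R₀ ^ 2 * N ^ 2 * 2) := by
    gcongr
  have e1 : 6000 * σ ^ 2 * (9 * N ^ 2) / (4 * a₀ ^ 2 * L ^ 2 * N ^ 2 * 5 * R₀ ^ 2) =
      2700 * (σ ^ 2 / (a₀ ^ 2 * L ^ 2 * R₀ ^ 2)) := by field_simp; ring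
  have e2 : 10368 * σ ^ 2 * (9 * N ^ 2) / (4 * a₀ ^ 2 * L ^ 2 * 5 * R₀ ^ 2 * N ^ 2 * 2) =
      11664 / 5 * (σ ^ 2 / (a₀ ^ 2 * L ^ 2 * R₀ ^ 2)) := by field_simp; ring
  have h0 : 0 ≤ σ ^ 2 / (a₀ ^ 2 * L ^ 2 * R₀ ^ 2) := by positivity
  rw [e1] at t1
  rw [e2] at t2
  linarith

lemma oracleCalls_le {L σ R₀ a β C : ℝ} {N : ℕ}
    (h : ∀ k < N, (batchSize L σ R₀ a N β k : ℝ) ≤ C) :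
    (oracleCalls L σ R₀ a N β : ℝ) ≤ N * C := by
  rw [oracleCalls, Nat.cast_sum]
  refine (Finset.sum_le_sum fun k hk => h k (Finset.mem_range.1 hk)).trans ?_
  simp

/-- Needed because only an upper bound on `N` is available, so `log (4 N / β)` may be far smaller
than `log (u / β)`. If they are comparable, squaring the bound on `N` suffices; otherwise `N` is
tiny. -/
lemma sq_div_log_le {u β N K : ℝ} (hK : 1 ≤ K) (hN : 1 ≤ N) (hβ : 0 < β) (hβ1 : β < 1)
    (hl : 2 ≤ Real.log (4 * N / β)) (hu : 0 < u) (hNu : N ≤ 2 * K * (u * Real.log (u / β))) :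
    N ^ 2 / Real.log (4 * N / β) ≤ 8 * K ^ 2 * (u ^ 2 * Real.log (u / β)) := by
  set l := Real.log (4 * N / β) with hldef
  set lam := Real.log (u / β) with hlam
  have hl0 : 0 < l := by linarith
  have hulam : 0 < u * lam := by
    by_contra h
    nlinarith [mul_nonneg (by linarith : 0 ≤ K) (neg_nonneg.2 (not_lt.1 h))]
  have hlam0 : 0 < lam := (pos_iff_pos_of_mul_pos hulam).1 hu
  rw [div_le_iff₀ hl0]
  rcases le_or_gt lam (2 * l) with h | h
  · calc N ^ 2 ≤ (2 * K * (u * lam)) ^ 2 := pow_le_pow_left₀ (by linarith) hNu 2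
      _ = 4 * K ^ 2 * (u ^ 2 * lam) * lam := by ring
      _ ≤ 4 * K ^ 2 * (u ^ 2 * lam) * (2 * l) := by gcongr
      _ = 8 * K ^ 2 * (u ^ 2 * lam) * l := by ring
  -- Here `N² ≤ u`, and the claim holds with much to spare.
  · have h1 : (4 * N / β) ^ 2 < u / β := by
      rw [← Real.log_lt_log_iff (by positivity) (by positivity), Real.log_pow]
      push_cast
      exact h
    have h2 : N ^ 2 ≤ u := by
      rw [div_pow, div_lt_div_iff₀ (by positivity) hβ] at h1
      have h3 : (4 * N) ^ 2 < u * β := by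
        refine lt_of_mul_lt_mul_right ?_ hβ.le
        calc (4 * N) ^ 2 * β < u * β ^ 2 := h1
          _ = u * β * β := by ring
      nlinarith
    have h3 : 1 ≤ u := le_trans (by nlinarith) h2
    have h4 : 1 ≤ lam * l := by nlinarith
    have h5 : 1 ≤ 8 * K ^ 2 := by nlinarith
    calc N ^ 2 ≤ u ^ 2 := h2.trans (by nlinarith)
      _ ≤ u ^ 2 * (lam * l) := le_mul_of_one_le_right (by positivity) h4
      _ ≤ 8 * K ^ 2 * (u ^ 2 * (lam * l)) := le_mul_of_one_le_left (by positivity) h5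
      _ = 8 * K ^ 2 * (u ^ 2 * lam) * l := by ring

end ClippedSSTM

/-! ### Accuracy and oracle complexity in terms of `ε` -/

namespace ClippedSSTM

/-- Admissibility makes the medium-batch rate `10 L R₀² log (4 N / β) / (N + 3)` at most `ε`. -/
lemma gap_bound_medium {L R₀ ε β : ℝ} {N : ℕ} (hε : 0 < ε) (hβ : 0 < β)
    (hβ1 : β < 1) (hadm : Admissible N β (aMedium N β))
    (hN : 65536 * (L * R₀ ^ 2 / ε * Real.log (L * R₀ ^ 2 / (ε * β))) ≤ N) :
    10 * aMedium N β * L * R₀ ^ 2 / (N * (N + 3)) ≤ ε := by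
  have hsq := hadm.sq_le
  obtain ⟨hN1, hl, -⟩ := hadm
  have hNpos : (0 : ℝ) < N := by exact_mod_cast hN1
  rw [← div_div] at hN
  rw [aMedium] at hsq ⊢
  have key : 10 * logN N β * (L * R₀ ^ 2 / ε) ≤ N := by
    rcases le_or_gt 2 (L * R₀ ^ 2 / ε) with hu | hu
    · have h := mul_log_le_of_le (p := 1) (N := N) one_le_two hu hβ hβ1 (by rwa [pow_one])
      change 700 * _ ^ 1 * logN N β ≤ N at h
      nlinarith
    -- When `L R₀² / ε < 2` the logarithmic inversion is not available, but admissibility alone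
    -- already makes `N` large enough.
    · have h : 576 * logN N β ≤ N := by
        refine le_of_mul_le_mul_right ?_ (by linarith : 0 < logN N β)
        nlinarith
      nlinarith
  have e : 10 * (N * logN N β) * L * R₀ ^ 2 / (N * (N + 3)) =
      ε * ((10 * logN N β * (L * R₀ ^ 2 / ε)) / (N + 3)) := by field_simp
  rw [e]
  refine mul_le_of_le_one_right hε.le ((div_le_one (by positivity)).2 (by linarith))

/-- The constant-batch rate is at most `ε` after `≳ v² log (v / β)` iterations. -/
lemma gap_bound_const {a₀ D ε β : ℝ} {N : ℕ} (hε : 0 < ε) (hβ : 0 < β)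
    (hβ1 : β < 1) (hv : 2 ≤ a₀ * D / ε) (hl : 2 ≤ logN N β)
    (hN : 65536 * ((a₀ * D / ε) ^ 2 * Real.log (a₀ * D / ε / β)) ≤ N) :
    10 * aConst a₀ N β * D / (N * (N + 3)) ≤ ε := by
  have h := mul_log_le_of_le le_rfl hv hβ hβ1 hN
  change 700 * _ ^ 2 * logN N β ≤ N at h
  have hNpos : (0 : ℝ) < N := by
    refine lt_of_lt_of_le ?_ h
    positivity
  rw [aConst, rpow_three_halves _ hNpos.le]
  set l := logN N β
  have hs : √l ^ 2 = l := Real.sq_sqrt (by linarith)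
  have hsN : √(N : ℝ) ^ 2 = N := Real.sq_sqrt hNpos.le
  set v := a₀ * D / ε with hvdef
  have h3 : 10 * v * √l ≤ √N := by
    refine Real.le_sqrt_of_sq_le ?_
    rw [mul_pow, hs]
    nlinarith [mul_nonneg (sq_nonneg v) (by linarith : 0 ≤ l)]
  have e : 10 * (a₀ * (N * √N) * √l) * D / (N * (N + 3)) =
      ε * ((√N * (10 * v * √l)) / (N + 3)) := by
    rw [hvdef]; field_simp
  rw [e]
  refine mul_le_of_le_one_right hε.le ((div_le_one (by positivity)).2 ?_)
  have := mul_le_mul_of_nonneg_left h3 (Real.sqrt_nonneg (N : ℝ))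
  nlinarith

lemma oracleCalls_medium_le {L σ R₀ ε β : ℝ} {N : ℕ} (hL : 0 < L) (hR₀ : 0 < R₀) (hε : 0 < ε)
    (hβ : 0 < β) (hβ1 : β < 1) (hN1 : 1 ≤ N) (hl : 2 ≤ logN N β)
    (hN : N ≤ 2 * 65536 * (L * R₀ ^ 2 / ε * Real.log (L * R₀ ^ 2 / (ε * β)))) :
    (oracleCalls L σ R₀ (aMedium N β) N β : ℝ) ≤
      10 ^ 14 * (max (L * R₀ ^ 2 / ε) (σ ^ 2 * R₀ ^ 2 / ε ^ 2) *
        Real.log (L * R₀ ^ 2 / (ε * β))) := by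
  have hN1' : (1 : ℝ) ≤ N := by exact_mod_cast hN1
  refine (oracleCalls_le fun k hk => batchSize_medium_le hL hR₀ hl hk).trans ?_
  rw [← div_div (L * R₀ ^ 2)] at hN ⊢
  have hu : 0 < L * R₀ ^ 2 / ε := by positivity
  have hW : σ ^ 2 / (L ^ 2 * R₀ ^ 2) * (L * R₀ ^ 2 / ε) ^ 2 = σ ^ 2 * R₀ ^ 2 / ε ^ 2 := by
    field_simp
  set u := L * R₀ ^ 2 / ε
  set lam := Real.log (u / β)
  have hsq : (N : ℝ) ^ 2 / logN N β ≤ 8 * 65536 ^ 2 * (u ^ 2 * lam) :=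
    sq_div_log_le (by norm_num) hN1' hβ hβ1 hl hu hN
  -- No upper bound on `ε` is assumed; the sign of the logarithm follows from `1 ≤ N` and the upper
  -- bound on `N`.
  have hlam : 0 ≤ lam := by
    by_contra h
    nlinarith [mul_pos hu (neg_pos.2 (not_le.1 h))]
  set W := σ ^ 2 / (L ^ 2 * R₀ ^ 2)
  have hW0 : 0 ≤ W := by positivity
  set M := max u (σ ^ 2 * R₀ ^ 2 / ε ^ 2)
  have h1 : u * lam ≤ M * lam := mul_le_mul_of_nonneg_right (le_max_left _ _) hlam
  have h2 : W * (u ^ 2 * lam) ≤ M * lam := by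
    rw [← mul_assoc, hW]
    exact mul_le_mul_of_nonneg_right (le_max_right _ _) hlam
  have h3 := mul_le_mul_of_nonneg_left hsq hW0
  have e : (N : ℝ) * (2 + 2300 * W * (N / logN N β)) =
      2 * N + 2300 * (W * (N ^ 2 / logN N β)) := by ring
  rw [e]
  have h4 : 0 ≤ M * lam := le_trans (by positivity) h1
  norm_num at *
  linarith

lemma oracleCalls_const_le {a₀ L σ R₀ ε β : ℝ} {N : ℕ} (hL : 0 < L) (hR₀ : 0 < R₀)
    (ha₀ : 0 < a₀) (hε : 0 < ε) (hN1 : 1 ≤ N) (hl : 2 ≤ logN N β)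
    (hN : N ≤ 2 * 65536 * (a₀ ^ 2 * L ^ 2 * R₀ ^ 4 / ε ^ 2 *
      Real.log (a₀ * L * R₀ ^ 2 / (ε * β)))) :
    (oracleCalls L σ R₀ (aConst a₀ N β) N β : ℝ) ≤
      10 ^ 14 * (max (a₀ ^ 2 * L ^ 2 * R₀ ^ 4 / ε ^ 2) (σ ^ 2 * R₀ ^ 2 / ε ^ 2) *
        Real.log (a₀ * L * R₀ ^ 2 / (ε * β))) := by
  have hN1' : (1 : ℝ) ≤ N := by exact_mod_cast hN1
  refine (oracleCalls_le fun k hk => batchSize_const_le hL hR₀ ha₀ hN1 hl hk.le).trans ?_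
  have hV : 0 < a₀ ^ 2 * L ^ 2 * R₀ ^ 4 / ε ^ 2 := by positivity
  have hq : σ ^ 2 / (a₀ ^ 2 * L ^ 2 * R₀ ^ 2) * (a₀ ^ 2 * L ^ 2 * R₀ ^ 4 / ε ^ 2) =
      σ ^ 2 * R₀ ^ 2 / ε ^ 2 := by field_simp
  set V := a₀ ^ 2 * L ^ 2 * R₀ ^ 4 / ε ^ 2
  set lam := Real.log (a₀ * L * R₀ ^ 2 / (ε * β))
  have hlam : 0 ≤ lam := by
    by_contra h
    nlinarith [mul_pos hV (neg_pos.2 (not_le.1 h))]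
  set q := σ ^ 2 / (a₀ ^ 2 * L ^ 2 * R₀ ^ 2)
  have hq0 : 0 ≤ q := by positivity
  set M := max V (σ ^ 2 * R₀ ^ 2 / ε ^ 2)
  have h1 : V * lam ≤ M * lam := mul_le_mul_of_nonneg_right (le_max_left _ _) hlam
  have h2 : q * (V * lam) ≤ M * lam := by
    rw [← mul_assoc, hq]
    exact mul_le_mul_of_nonneg_right (le_max_right _ _) hlam
  have h3 := mul_le_mul_of_nonneg_left hN hq0
  have h4 : 0 ≤ M * lam := le_trans (by positivity) h1
  have e : (N : ℝ) * (2 + 5100 * q) = 2 * N + 5100 * (q * N) := by ring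
  rw [e]
  norm_num at *
  linarith

end ClippedSSTM

/-! ### Assembly of the three regimes -/

theorem mainTheorem2 :
    ∃ K K' : ℝ, 0 < K ∧ 0 < K' ∧
      ∀ (n : ℕ) (Ξ : Type*) (Ω : Type*) [MeasurableSpace Ξ] [MeasurableSpace Ω]
        (P : Measure Ξ) [IsProbabilityMeasure P] (μ : Measure Ω) [IsProbabilityMeasure μ]
        (f : ClippedSSTM.Euc n → ℝ) (G : ClippedSSTM.Euc n → Ξ → ClippedSSTM.Euc n)
        (ξ : ℕ × ℕ → Ω → Ξ) (x₀ xs : ClippedSSTM.Euc n) (L σ R₀ β : ℝ),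
        0 < L → 0 ≤ σ → 0 < β → β < 1 →
        ConvexOn ℝ Set.univ f → ClippedSSTM.LSmooth f L →
        ClippedSSTM.IsStochasticGradient f P G σ →
        ClippedSSTM.IsIIDSample μ P ξ →
        (∀ x, f xs ≤ f x) → R₀ = ‖x₀ - xs‖ → 0 < R₀ →
        -- medium batchsizes
        ((∀ N : ℕ, ClippedSSTM.Admissible N β (ClippedSSTM.aMedium N β) →
            (∀ k : ℕ, ClippedSSTM.batchReal L σ R₀ (ClippedSSTM.aMedium N β) N β k =
              max 1 (max
                (6000 * σ ^ 2 * ((k : ℝ) + 2) ^ 2 /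
                  (4 * L ^ 2 * N * √5 ^ 2 * R₀ ^ 2 * Real.log (4 * N / β)))
                (10368 * σ ^ 2 * ((k : ℝ) + 2) ^ 2 /
                  (4 * L ^ 2 * √5 ^ 2 * R₀ ^ 2 * N * Real.log (4 * N / β) ^ 2)))) ∧
            (∀ ε : ℝ, 0 < ε →
              K * (L * R₀ ^ 2 / ε * Real.log (L * R₀ ^ 2 / (ε * β))) ≤ N →
              1 - β ≤ μ.real {ω | f (ClippedSSTM.output G ξ x₀ L σ R₀
                (ClippedSSTM.aMedium N β) N β ω) - f xs ≤ ε}) ∧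
            (∀ ε : ℝ, 0 < ε →
              N ≤ 2 * K * (L * R₀ ^ 2 / ε * Real.log (L * R₀ ^ 2 / (ε * β))) →
              (ClippedSSTM.oracleCalls L σ R₀ (ClippedSSTM.aMedium N β) N β : ℝ) ≤
                K' * (max (L * R₀ ^ 2 / ε) (σ ^ 2 * R₀ ^ 2 / ε ^ 2) *
                  Real.log (L * R₀ ^ 2 / (ε * β))))) ∧
          (∀ ε : ℝ, 0 < ε → ε ≤ L * R₀ ^ 2 / 2 →
            ∃ N : ℕ, ClippedSSTM.Admissible N β (ClippedSSTM.aMedium N β) ∧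
              K * (L * R₀ ^ 2 / ε * Real.log (L * R₀ ^ 2 / (ε * β))) ≤ N ∧
              N ≤ 2 * K * (L * R₀ ^ 2 / ε * Real.log (L * R₀ ^ 2 / (ε * β))))) ∧
        -- constant batchsizes
        (∀ a₀ : ℝ, 0 < a₀ →
          (∀ N : ℕ, ClippedSSTM.Admissible N β (ClippedSSTM.aConst a₀ N β) →
            (∀ k : ℕ, ClippedSSTM.batchReal L σ R₀ (ClippedSSTM.aConst a₀ N β) N β k =
              max 1 (max
                (6000 * σ ^ 2 * ((k : ℝ) + 2) ^ 2 /
                  (4 * a₀ ^ 2 * L ^ 2 * N ^ 2 * √5 ^ 2 * R₀ ^ 2))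
                (10368 * σ ^ 2 * ((k : ℝ) + 2) ^ 2 /
                  (4 * a₀ ^ 2 * L ^ 2 * √5 ^ 2 * R₀ ^ 2 * N ^ 2 * Real.log (4 * N / β))))) ∧
            (∀ ε : ℝ, 0 < ε → ε ≤ a₀ * L * R₀ ^ 2 / 2 →
              K * (a₀ ^ 2 * L ^ 2 * R₀ ^ 4 / ε ^ 2 *
                Real.log (a₀ * L * R₀ ^ 2 / (ε * β))) ≤ N →
              1 - β ≤ μ.real {ω | f (ClippedSSTM.output G ξ x₀ L σ R₀
                (ClippedSSTM.aConst a₀ N β) N β ω) - f xs ≤ ε}) ∧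
            (∀ ε : ℝ, 0 < ε →
              N ≤ 2 * K * (a₀ ^ 2 * L ^ 2 * R₀ ^ 4 / ε ^ 2 *
                Real.log (a₀ * L * R₀ ^ 2 / (ε * β))) →
              (ClippedSSTM.oracleCalls L σ R₀ (ClippedSSTM.aConst a₀ N β) N β : ℝ) ≤
                K' * (max (a₀ ^ 2 * L ^ 2 * R₀ ^ 4 / ε ^ 2) (σ ^ 2 * R₀ ^ 2 / ε ^ 2) *
                  Real.log (a₀ * L * R₀ ^ 2 / (ε * β))))) ∧
          (∀ ε : ℝ, 0 < ε → ε ≤ a₀ * L * R₀ ^ 2 / 2 → ε ^ 3 ≤ a₀ ^ 4 * (L * R₀ ^ 2) ^ 3 →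
            ∃ N : ℕ, ClippedSSTM.Admissible N β (ClippedSSTM.aConst a₀ N β) ∧
              K * (a₀ ^ 2 * L ^ 2 * R₀ ^ 4 / ε ^ 2 *
                Real.log (a₀ * L * R₀ ^ 2 / (ε * β))) ≤ N ∧
              N ≤ 2 * K * (a₀ ^ 2 * L ^ 2 * R₀ ^ 4 / ε ^ 2 *
                Real.log (a₀ * L * R₀ ^ 2 / (ε * β))))) ∧
        -- constant batchsizes with `a₀ = σ / (L R₀)`
        (0 < σ →
          (∀ N : ℕ, ClippedSSTM.Admissible N β (ClippedSSTM.aConst (σ / (L * R₀)) N β) →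
            (∀ k : ℕ, k ≤ N → (ClippedSSTM.batchSize L σ R₀
              (ClippedSSTM.aConst (σ / (L * R₀)) N β) N β k : ℝ) ≤ K') ∧
            (∀ ε : ℝ, 0 < ε → ε ≤ σ * R₀ / 2 →
              K * (σ ^ 2 * R₀ ^ 2 / ε ^ 2 * Real.log (σ * R₀ / (ε * β))) ≤ N →
              1 - β ≤ μ.real {ω | f (ClippedSSTM.output G ξ x₀ L σ R₀
                (ClippedSSTM.aConst (σ / (L * R₀)) N β) N β ω) - f xs ≤ ε})) ∧
          (∀ ε : ℝ, 0 < ε → ε ≤ σ * R₀ / 2 → L * ε ^ 3 ≤ σ ^ 4 * R₀ ^ 2 →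
            ∃ N : ℕ, ClippedSSTM.Admissible N β (ClippedSSTM.aConst (σ / (L * R₀)) N β) ∧
              K * (σ ^ 2 * R₀ ^ 2 / ε ^ 2 * Real.log (σ * R₀ / (ε * β))) ≤ N ∧
              N ≤ 2 * K * (σ ^ 2 * R₀ ^ 2 / ε ^ 2 * Real.log (σ * R₀ / (ε * β))))) := by
  -- `65536` is the constant of `mul_log_le_of_le`; `10 ^ 14` exceeds `2300 * 8 * 65536 ^ 2 + 4 *
  -- 65536`, the cost in the medium regime, which is the most demanding.
  refine ⟨65536, 10 ^ 14, by norm_num, by norm_num, ?_⟩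
  intro n Ξ Ω _ _ P _ μ _ f G ξ x₀ xs L σ R₀ β hL hσ hβ hβ1 hc hf hG hξ hxs hR₀ hR₀pos
  have hgap : ∀ {N : ℕ} {a ε : ℝ}, ClippedSSTM.Admissible N β a →
      10 * a * L * R₀ ^ 2 / (N * (N + 3)) ≤ ε →
      1 - β ≤ μ.real {ω | f (ClippedSSTM.output G ξ x₀ L σ R₀ a N β ω) - f xs ≤ ε} :=
    fun hadm hε => (ClippedSSTM.output_gap_le hL hβ hc hf hG hξ hxs hR₀ hR₀pos hadm).trans
      (measureReal_mono fun ω hω => le_trans (show _ ≤ _ from hω) hε)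
  -- In terms of `v = a₀ L R₀² / ε` the constant-batch threshold is `v² log (v / β)`, the case `p =
  -- 2` of the inversion lemma.
  have hsq : ∀ a₀ ε : ℝ, a₀ ^ 2 * L ^ 2 * R₀ ^ 4 / ε ^ 2 = (a₀ * (L * R₀ ^ 2) / ε) ^ 2 :=
    fun a₀ ε => by ring
  have hlog : ∀ a₀ ε : ℝ, a₀ * L * R₀ ^ 2 / (ε * β) = a₀ * (L * R₀ ^ 2) / ε / β :=
    fun a₀ ε => by rw [div_div, mul_assoc]
  have hrate : ∀ a₀ : ℝ, ∀ N : ℕ, ClippedSSTM.Admissible N β (ClippedSSTM.aConst a₀ N β) →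
      ∀ ε : ℝ, 0 < ε → ε ≤ a₀ * L * R₀ ^ 2 / 2 →
        65536 * (a₀ ^ 2 * L ^ 2 * R₀ ^ 4 / ε ^ 2 *
          Real.log (a₀ * L * R₀ ^ 2 / (ε * β))) ≤ N →
        1 - β ≤ μ.real {ω | f (ClippedSSTM.output G ξ x₀ L σ R₀
          (ClippedSSTM.aConst a₀ N β) N β ω) - f xs ≤ ε} := by
    intro a₀ N hadm ε hε hε2 hN
    refine hgap hadm ?_
    rw [mul_assoc (10 * _)]
    rw [hsq, hlog] at hN
    exact ClippedSSTM.gap_bound_const hε hβ hβ1 ((le_div_iff₀ hε).2 (by linarith)) hadm.2.1 hN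
  have hexists : ∀ a₀ : ℝ, ∀ ε : ℝ, 0 < ε → ε ≤ a₀ * L * R₀ ^ 2 / 2 →
      ε ^ 3 ≤ a₀ ^ 4 * (L * R₀ ^ 2) ^ 3 →
        ∃ N : ℕ, ClippedSSTM.Admissible N β (ClippedSSTM.aConst a₀ N β) ∧
          65536 * (a₀ ^ 2 * L ^ 2 * R₀ ^ 4 / ε ^ 2 *
            Real.log (a₀ * L * R₀ ^ 2 / (ε * β))) ≤ N ∧
          N ≤ 2 * 65536 * (a₀ ^ 2 * L ^ 2 * R₀ ^ 4 / ε ^ 2 *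
            Real.log (a₀ * L * R₀ ^ 2 / (ε * β))) := by
    intro a₀ ε hε hε2 hε3
    rw [hsq, hlog]
    refine ClippedSSTM.exists_admissible_const ((le_div_iff₀ hε).2 (by linarith)) ?_ hβ hβ1
    rw [div_pow, ← mul_div_assoc, le_div_iff₀ (by positivity)]
    linarith
  refine ⟨⟨fun N hadm => ⟨ClippedSSTM.batchReal_medium hadm.1 hadm.2.1, fun ε hε hN =>
      hgap hadm (ClippedSSTM.gap_bound_medium hε hβ hβ1 hadm hN), fun ε hε hN =>
      ClippedSSTM.oracleCalls_medium_le hL hR₀pos hε hβ hβ1 hadm.1 hadm.2.1 hN⟩, ?_⟩,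
    fun a₀ ha₀ => ⟨fun N hadm => ⟨ClippedSSTM.batchReal_const hadm.1 hadm.2.1, hrate a₀ N hadm,
      fun ε hε hN => ClippedSSTM.oracleCalls_const_le hL hR₀pos ha₀ hε hadm.1 hadm.2.1 hN⟩,
      hexists a₀⟩, ?_⟩
  · intro ε hε hε2
    rw [← div_div]
    exact ClippedSSTM.exists_admissible_medium ((le_div_iff₀ hε).2 (by linarith)) hβ hβ1
  · intro hσpos
    have ha₀ : 0 < σ / (L * R₀) := by positivity
    have e1 : σ / (L * R₀) * L * R₀ ^ 2 = σ * R₀ := by field_simp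
    have e2 : (σ / (L * R₀)) ^ 2 * L ^ 2 * R₀ ^ 4 = σ ^ 2 * R₀ ^ 2 := by field_simp
    refine ⟨fun N hadm => ⟨fun k hk => ?_, fun ε hε hε2 hN => ?_⟩, fun ε hε hε2 hε3 => ?_⟩
    · refine (ClippedSSTM.batchSize_const_le hL hR₀pos ha₀ hadm.1 hadm.2.1 hk).trans ?_
      have e3 : σ ^ 2 / ((σ / (L * R₀)) ^ 2 * L ^ 2 * R₀ ^ 2) = 1 := by field_simp
      rw [e3]; norm_num
    · exact hrate _ N hadm ε hε (by rwa [e1]) (by rwa [e1, e2])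
    · have h := hexists _ ε hε (by rwa [e1]) ?_
      · rwa [e1, e2] at h
      · have e4 : (σ / (L * R₀)) ^ 4 * (L * R₀ ^ 2) ^ 3 = σ ^ 4 * R₀ ^ 2 / L := by field_simp
        rw [e4, le_div_iff₀ hL]
        linarith
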